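/- **Simple neural programs.** A simple neural program (SNP) $P$ has $V$ variables, of which $I$ are inputs and the others have fixed nonnegative integer initial values. It is a finite sequence of statements followed by one statement "return $x$", where $x$ is a variable. The statements are: $x=a$; $x = a$ if $b$ else $a'$ (where $a,a'$ are variables or nonnegative integer constants, and the variable $b$ is tested for being $1$); $x=y+c$ ($c\in\mathbb Z$ constant); $x=c\cdot y$ ($c\in\mathbb Z_{\ge0}$ constant); $x=y\pm z$; $x=(y\bowtie c)$ and $x=(y\bowtie z)$ with $\bowtie\ \in\{=,<,\le,>,\ge\}$ and result $0$ or $1$; and loops "for $x=a,\dots,e$" with a clause that is itself a sequence of statements, where $a,e$ are variables or constants, the clause modifies neither $x$ nor $e$, and $e\ne x$. Loops run as in Python. The length $L$ of $P$ is its number of statements, including the return statement and the statements in clauses (but not variable declarations). Write $P(x)$ for the value returned on input $x\in[N]^I$, $[N]=\{1,\dots,N\}$. $P$ is bounded by $B(N)$ if its constants are at most $B(N)$ in absolute value and, for every input in $[N]^I$, all variables stay in $\{0,\dots,B(N)\}$ throughout the run. **Networks and description length.** A network is a map $g_D\circ\sigma\circ g_{D-1}\circ\cdots\circ\sigma\circ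 g_1$ with $D\ge1$, $g_i(z)=W_iz+b_i$, integer $W_i,b_i$, $\sigma(t)=\max(t,0)$ coordinatewise, and one output node, applied to an input vector in which $I$ coordinates are free (filled in order by $x_1,\dots,x_I$) and the others are fixed integers. Its symbol encoding is the comma-separated sequence consisting of the input coordinates (the symbol $\mathcal I$ for a free one) and then, for each layer, the symbol $\mathcal W$, the entries of $W_i$ row by row, the symbol $\mathcal B$, and the entries of $b_i$; integers are written in binary with a minus sign if negative. A string may abbreviate the $k$-fold repetition of a substring $u$ by $(u)*k$, with $k$ in binary and nesting allowed. The description length of a network is the least number of symbols of a string (over the alphabet $\mathcal I$ , comma, $-,0,1,*,(,),\mathcal W,\mathcal B$) that expands to its symbol encoding. A minimum-description-length (MDL) interpolator of a dataset is a network of least description length among all networks that take the prescribed values at all data points. **Theorem.** There are an absolute constant $c_3>0$ and constants $K_{I,L,V}$ depending only on $I,L,V$ such that the following holds. Let $P$ be an SNP of length $L$ with $I$ inputs and $V\ge I$ variables, bounded by $B(N)\ge2$ on $[N]^I$. Let $X_1,\dots,X_n$ be i.i.d. uniform on $[N]^I$, let $\rho\ge0$, and let $\tilde Y_1,\dots,\tilde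 Y_n\in\{0,1,\dots,B(N)\}$ be labels, with arbitrary dependence on the $X_i$ and on each other, such that $\tilde Y_i\ne P(X_i)$ for at most $\rho n$ indices $i$. Let $\widehat f$ be a (random) MDL interpolator of the corrupted data $(X_i,\tilde Y_i)_{i=1}^n$ (which is thus assumed to exist). Let $x$ be uniform on $[N]^I$ and independent of the data and of $\widehat f$. (a) For every $\varepsilon>0$, with probability greater than $$1-\exp\Bigl(c_3\,(L^3V^2+I\rho n)\,\ln(I+B(N))-\frac{n\varepsilon^2}{2\rho+2\varepsilon}\Bigr),$$ the error rate of $\widehat f$, i.e. the proportion of $x\in[N]^I$ with $\widehat f(x)\ne P(x)$, is at most $\rho+\varepsilon$. (b) If $\rho>0$ and $n\ge1$, then $$\mathbb P\bigl(\widehat f(x)\ne P(x)\bigr)\le C\rho+K_{I,L,V}\,\frac{\rho^{-1}\ln B(N)}{n},\qquad C=1+2b_1+\sqrt{2b_1},\quad b_1=c_3I\ln(I+B(N)),$$ with the same $c_3$ as in (a). -/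

import Mathlib

open MeasureTheory ProbabilityTheory

noncomputable section

/-! ## Simple neural programs -/

/-- The variables of a program: `I` input variables and `J` initialised variables, so the
variable context has size `V = I + J`. -/
abbrev Var (I J : ℕ) : Type := Fin I ⊕ Fin J

/-- A right-hand side that is either a fixed nonnegative integer or a variable. -/
inductive Operand (I J : ℕ) : Type
  | const (c : ℕ)
  | var (v : Var I J)

/-- The comparisons `==`, `<`, `<=`, `>`, `>=`. -/
inductive Cmp : Type
  | eq | lt | le | gt | ge

/-- The statements other than `for` loops and the final `return`.  A boolean variable is a variable
holding `0` or `1`; no typing discipline is imposed, so that every typed program is covered. -/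
inductive Instr (I J : ℕ) : Type
  /-- `x = a` -/
  | assign (x : Var I J) (a : Operand I J)
  /-- `x = a if b else a'` -/
  | cond (x : Var I J) (b : Var I J) (a a' : Operand I J)
  /-- `x = y + c` with a fixed integer `c` -/
  | addConst (x y : Var I J) (c : ℤ)
  /-- `x = c * y` with a fixed nonnegative integer `c` -/
  | mulConst (x : Var I J) (c : ℕ) (y : Var I J)
  /-- `x = (y == c)`, and similarly for the other comparisons -/
  | cmpConst (x : Var I J) (r : Cmp) (y : Var I J) (c : ℕ)
  /-- `x = y + z` -/
  | add (x y z : Var I J)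
  /-- `x = y - z` -/
  | sub (x y z : Var I J)
  /-- `x = (y == z)`, and similarly for the other comparisons -/
  | cmpVar (x : Var I J) (r : Cmp) (y z : Var I J)

/-- A block, i.e. a finite sequence of statements, each of them an `Instr` or a `for` loop. -/
inductive Block (I J : ℕ) : Type
  | nil
  | instr (s : Instr I J) (rest : Block I J)
  /-- `for x = a,...,e:` with clause `body`, followed by the statements `rest` -/
  | loop (x : Var I J) (a e : Operand I J) (body rest : Block I J)

/-- The values of all variables.  Values are integers, so that a subtraction can be seen to leave
the nonnegative integers; such runs are excluded by `Block.RunsWithin`. -/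
abbrev State (I J : ℕ) : Type := Var I J → ℤ

def Operand.val {I J : ℕ} (σ : State I J) : Operand I J → ℤ
  | .const c => c
  | .var v => σ v

/-- The truth value of a comparison, encoded by `0` or `1`. -/
def Cmp.val (y z : ℤ) : Cmp → ℤ
  | .eq => if y = z then 1 else 0
  | .lt => if y < z then 1 else 0
  | .le => if y ≤ z then 1 else 0
  | .gt => if y > z then 1 else 0
  | .ge => if y ≥ z then 1 else 0

def Instr.exec {I J : ℕ} (σ : State I J) : Instr I J → State I J
  | .assign x a => Function.update σ x (a.val σ)
  | .cond x b a a' => Function.update σ x (if σ b = 1 then a.val σ else a'.val σ)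
  | .addConst x y c => Function.update σ x (σ y + c)
  | .mulConst x c y => Function.update σ x (c * σ y)
  | .cmpConst x r y c => Function.update σ x (r.val (σ y) c)
  | .add x y z => Function.update σ x (σ y + σ z)
  | .sub x y z => Function.update σ x (σ y - σ z)
  | .cmpVar x r y z => Function.update σ x (r.val (σ y) (σ z))

/-- The state after `k` repetitions of a loop whose clause acts by `f` and whose counter `x` takes
the successive values `a`, `a + 1`, ... at the start of the repetitions. -/
def loopState {I J : ℕ} (f : State I J → State I J) (x : Var I J) (a : ℤ) (σ : State I J) :
    ℕ → State I J
  | 0 => σ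
  | k + 1 => f (Function.update (loopState f x a σ k) x (a + k))

/-- The number of repetitions of a loop over `a, ..., e` (zero if `e < a`). -/
def loopCount (a e : ℤ) : ℕ := (e - a + 1).toNat

/-- Execution of a block.  As in Python, the bounds of a loop are evaluated on entry, and after the
loop the counter keeps its last value. -/
def Block.exec {I J : ℕ} : Block I J → State I J → State I J
  | .nil, σ => σ
  | .instr s rest, σ => rest.exec (s.exec σ)
  | .loop x a e body rest, σ =>
      rest.exec (loopState body.exec x (a.val σ) σ (loopCount (a.val σ) (e.val σ)))

/-- Throughout the run of the block from `σ`, every variable has a value in `{0, ..., B}`. -/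
def Block.RunsWithin {I J : ℕ} (B : ℕ) : Block I J → State I J → Prop
  | .nil, σ => ∀ v, 0 ≤ σ v ∧ σ v ≤ B
  | .instr s rest, σ => (∀ v, 0 ≤ σ v ∧ σ v ≤ B) ∧ rest.RunsWithin B (s.exec σ)
  | .loop x a e body rest, σ =>
      (∀ v, 0 ≤ σ v ∧ σ v ≤ B) ∧
      (∀ k < loopCount (a.val σ) (e.val σ),
        body.RunsWithin B
          (Function.update (loopState body.exec x (a.val σ) σ k) x (a.val σ + k))) ∧
      rest.RunsWithin B (loopState body.exec x (a.val σ) σ (loopCount (a.val σ) (e.val σ)))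

def Instr.target {I J : ℕ} : Instr I J → Var I J
  | .assign x _ => x
  | .cond x _ _ _ => x
  | .addConst x _ _ => x
  | .mulConst x _ _ => x
  | .cmpConst x _ _ _ => x
  | .add x _ _ => x
  | .sub x _ _ => x
  | .cmpVar x _ _ _ => x

/-- The block contains a statement that modifies the variable `v`. -/
def Block.Modifies {I J : ℕ} (v : Var I J) : Block I J → Prop
  | .nil => False
  | .instr s rest => s.target = v ∨ rest.Modifies v
  | .loop x _ _ body rest => x = v ∨ body.Modifies v ∨ rest.Modifies v

/-- No clause modifies the counter or the final variable of its loop, and the final variable of a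
loop is not its counter. -/
def Block.WellFormed {I J : ℕ} : Block I J → Prop
  | .nil => True
  | .instr _ rest => rest.WellFormed
  | .loop x _ e body rest =>
      ¬ body.Modifies x ∧ (∀ v, e = .var v → v ≠ x ∧ ¬ body.Modifies v) ∧
      body.WellFormed ∧ rest.WellFormed

/-- The number of statements, those in the clauses of loops included. -/
def Block.length {I J : ℕ} : Block I J → ℕ
  | .nil => 0
  | .instr _ rest => 1 + rest.length
  | .loop _ _ _ body rest => 1 + body.length + rest.length

def Operand.ConstsLe {I J : ℕ} (B : ℕ) : Operand I J → Prop
  | .const c => c ≤ B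
  | .var _ => True

def Instr.ConstsLe {I J : ℕ} (B : ℕ) : Instr I J → Prop
  | .assign _ a => a.ConstsLe B
  | .cond _ _ a a' => a.ConstsLe B ∧ a'.ConstsLe B
  | .addConst _ _ c => c.natAbs ≤ B
  | .mulConst _ c _ => c ≤ B
  | .cmpConst _ _ _ c => c ≤ B
  | .add _ _ _ => True
  | .sub _ _ _ => True
  | .cmpVar _ _ _ _ => True

/-- The constants that occur in the block do not exceed `B` (in absolute value). -/
def Block.ConstsLe {I J : ℕ} (B : ℕ) : Block I J → Prop
  | .nil => True
  | .instr s rest => s.ConstsLe B ∧ rest.ConstsLe B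
  | .loop _ a e body rest => a.ConstsLe B ∧ e.ConstsLe B ∧ body.ConstsLe B ∧ rest.ConstsLe B

/-- A simple neural program (SNP) with `I` inputs and `J` further variables: the initial values of
the latter, a sequence of statements, and the variable named by the final `return` statement. -/
structure SNP (I J : ℕ) where
  init : Fin J → ℕ
  body : Block I J
  ret : Var I J
  wellFormed : body.WellFormed

/-- The set of inputs `[N]^I`, where `[N] = {1, ..., N}`. -/
abbrev Input (I N : ℕ) : Type := Fin I → Set.Icc 1 N

/-- The number of statements of the program, the `return` statement included. -/
def SNP.length {I J : ℕ} (P : SNP I J) : ℕ := P.body.length + 1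

def SNP.start {I J N : ℕ} (P : SNP I J) (x : Input I N) : State I J :=
  Sum.elim (fun i => ((x i : ℕ) : ℤ)) (fun j => (P.init j : ℤ))

/-- The returned value `P(x)`. -/
def SNP.output {I J N : ℕ} (P : SNP I J) (x : Input I N) : ℤ := P.body.exec (P.start x) P.ret

/-- `P` is `B`-bounded on the inputs `[N]^I`: its constants do not exceed `B`, and for every input
all variables stay in `{0, ..., B}` throughout the run. -/
def SNP.BoundedOn {I J : ℕ} (P : SNP I J) (N B : ℕ) : Prop :=
  P.body.ConstsLe B ∧ ∀ x : Input I N, P.body.RunsWithin B (P.start x)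

/-! ## Feedforward ReLU networks with integer parameters -/

/-- The affine map `x ↦ W x + b` from `ℝⁿ` to `ℝᵐ`, with integer parameters. -/
structure Layer (n m : ℕ) where
  W : Matrix (Fin m) (Fin n) ℤ
  b : Fin m → ℤ

def Layer.eval {n m : ℕ} (l : Layer n m) (x : Fin n → ℝ) : Fin m → ℝ :=
  fun i => ∑ j, (l.W i j : ℝ) * x j + l.b i

/-- A nonempty sequence of composable layers, from `ℝⁿ` to one output node. -/
inductive Layers : ℕ → Type
  | out {n : ℕ} (l : Layer n 1) : Layers n
  | hidden {n m : ℕ} (l : Layer n m) (rest : Layers m) : Layers n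

/-- The composition of the affine maps with the ReLU `t ↦ max t 0` between consecutive ones. -/
def Layers.eval : {n : ℕ} → Layers n → (Fin n → ℝ) → ℝ
  | _, .out l, x => l.eval x 0
  | _, .hidden l rest, x => rest.eval (fun i => max (l.eval x i) 0)

/-- A feedforward network taking `I` inputs.  Its input vector is described by `spec`: `none` marks
a free coordinate, `some c` a coordinate with the fixed value `c`. -/
structure Network (I : ℕ) where
  spec : List (Option ℤ)
  free : spec.count none = I
  layers : Layers spec.length

/-- Random networks are random elements of a countable discrete space. -/
instance (I : ℕ) : MeasurableSpace (Network I) := ⊤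

/-- The input vector: the free coordinates are filled, in order, with `x₁, ..., x_I`. -/
def Network.inputVec {I N : ℕ} (F : Network I) (x : Input I N) : Fin F.spec.length → ℝ :=
  fun p => match F.spec.get p with
    | some c => (c : ℝ)
    | none =>
        if h : (F.spec.take p).count none < I then ((x ⟨(F.spec.take p).count none, h⟩ : ℕ) : ℝ)
        else 0 -- this case never occurs, since `spec` has exactly `I` free coordinates

def Network.eval {I N : ℕ} (F : Network I) (x : Input I N) : ℝ := F.layers.eval (F.inputVec x)

/-! ## Description length -/

/-- The alphabet: the input symbol, the comma, the symbols `-`, `0`, `1`, the symbols `*`, `(`, `)`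
for repetitions, and the symbols marking a weight matrix and a bias vector. -/
inductive Symb : Type
  | inp | comma | neg | zero | one | star | lpar | rpar | weight | bias

/-- Binary expansion, most significant digit first; the expansion of `0` is the digit `0`. -/
def binNat (k : ℕ) : List Symb :=
  if k = 0 then [.zero] else (Nat.bits k).reverse.map fun d => if d then .one else .zero

def binInt (z : ℤ) : List Symb := (if z < 0 then [.neg] else []) ++ binNat z.natAbs

/-- The entries of the symbol encoding of a layer: the weight symbol, the entries of the weight
matrix row by row, the bias symbol, the entries of the bias vector. -/
def Layer.tokens {n m : ℕ} (l : Layer n m) : List (List Symb) :=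
  [.weight] :: (List.ofFn fun i => List.ofFn fun j => binInt (l.W i j)).flatten ++
    [.bias] :: List.ofFn fun i => binInt (l.b i)

def Layers.tokens : {n : ℕ} → Layers n → List (List Symb)
  | _, .out l => l.tokens
  | _, .hidden l rest => l.tokens ++ rest.tokens

/-- The full symbol encoding of a network: its input coordinates and its parameters, separated by
commas. -/
def Network.encoding {I : ℕ} (F : Network I) : List Symb :=
  List.intercalate [.comma]
    (F.spec.map (fun o => match o with | none => [.inp] | some c => binInt c) ++ F.layers.tokens)

/-- `Expands s t`: expanding all repetitions in the symbol sequence `s` gives `t`.  The sequence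
`(u)*k`, with `k` in binary, stands for the `k`-fold repetition of `u`; repetitions may be nested.
The digits of `k` extend to the next symbol that is not a digit. -/
inductive Expands : List Symb → List Symb → Prop
  | nil : Expands [] []
  | symb (a : Symb) (s t : List Symb) (h₁ : a ≠ .star) (h₂ : a ≠ .lpar) (h₃ : a ≠ .rpar)
      (h : Expands s t) : Expands (a :: s) (a :: t)
  | rep (u v s t : List Symb) (k : ℕ) (hu : Expands u v) (hs : Expands s t)
      (h₀ : s.head? ≠ some .zero) (h₁ : s.head? ≠ some .one) :
      Expands (.lpar :: u ++ .rpar :: .star :: binNat k ++ s)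
        ((List.replicate k v).flatten ++ t)

/-- The minimum length of a symbol sequence that describes the network. -/
def Network.descLength {I : ℕ} (F : Network I) : ℕ :=
  sInf {k | ∃ s : List Symb, Expands s F.encoding ∧ s.length = k}

/-- The network takes the value `y i` at `x i`, for all `i`. -/
def Network.Interpolates {I N n : ℕ} (F : Network I) (x : Fin n → Input I N) (y : Fin n → ℕ) :
    Prop :=
  ∀ i, F.eval (x i) = y i

/-- `F` is a minimum-description length network interpolating the data `(x i, y i)`. -/
def Network.IsMDL {I N n : ℕ} (F : Network I) (x : Fin n → Input I N) (y : Fin n → ℕ) : Prop :=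
  F.Interpolates x y ∧ ∀ G : Network I, G.Interpolates x y → F.descLength ≤ G.descLength

/-! ## Errors -/

/-- The uniform distribution on `[N]^I`. -/
def unifInput (I N : ℕ) : Measure (Input I N) := uniformOn Set.univ

/-- The probability that `F` and `P` differ at a uniformly drawn test point. -/
def errorRate {I J : ℕ} (N : ℕ) (P : SNP I J) (F : Network I) : ℝ :=
  (unifInput I N).real {x | F.eval x ≠ P.output x}

end

/-! A network of description length at most D is determined by a word of at most D symbols from a
ten-letter alphabet, so there are at most 11 ^ D of them (`exists_finset_descLength_le`). An
interpolator differs from P at a sample point exactly where the label is corrupted, hence at most ρ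
n times. For a fixed network with error rate above ρ + ε so few sample errors have probability at
most exp (-n ε² / (2ρ + 2ε)), by Chernoff (`measure_count_le`). A union bound over the deterministic
set of short networks gives (a), however the labels depend on the sample (`measure_errorRate_gt`).

It remains to bound D for an MDL interpolator, by exhibiting one short interpolator
(`exists_network`, `descLength_le_of_isMDL`): run P, then correct the output at the corrupted
points. Two layers simulate an instruction by adding rectified integer affine forms to the state. A
loop becomes B + 1 copies of the layers of its clause, abbreviated by a repetition, so the copying
itself costs only O(log B) symbols. Superfluous copies, and loops that are not entered, are disabled
by a counter h: a large multiple of h is subtracted from every form, which silences it unless h = 0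
(`realizes_gated`, `realizes_block`). Each correction is a tent function of an integer tag
identifying the input and costs O(I log B) symbols (`realizes_memo_one`).

For (b), the tail bound is applied with ε equal to ρ (2b + √(2b)) plus a term of order 1 / n. The
tail is then at most exp (-ρ n / 2) (`tail_exponent_le`), and the test error is at most ρ + ε plus
this tail (`measure_error_le`). The cases I = 0 and ρ ≥ 1 are treated separately. -/

/-! ## Symbol sequences -/

instance : DecidableEq Symb := fun a b => by
  cases a <;> cases b <;> first | exact isTrue rfl | exact isFalse (by intro h; cases h)

instance : Fintype Symb :=
  ⟨{.inp, .comma, .neg, .zero, .one, .star, .lpar, .rpar, .weight, .bias}, by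
    intro a; cases a <;> decide⟩

theorem card_symb : Fintype.card Symb = 10 := by decide

/-- A sequence splits uniquely at the first element violating `p`. -/
theorem append_inj_of_head {α : Type*} (p : α → Prop) {t t' r r' : List α}
    (ht : ∀ a ∈ t, p a) (ht' : ∀ a ∈ t', p a)
    (hr : ∀ a, r.head? = some a → ¬ p a) (hr' : ∀ a, r'.head? = some a → ¬ p a)
    (h : t ++ r = t' ++ r') : t = t' ∧ r = r' := by
  induction t generalizing t' with
  | nil =>
    cases t' with
    | nil => exact ⟨rfl, h⟩
    | cons b t' =>
      simp only [List.nil_append, List.cons_append] at h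
      exact absurd (ht' b (by simp)) (hr b (by simp [h]))
  | cons a t ih =>
    cases t' with
    | nil =>
      simp only [List.nil_append, List.cons_append] at h
      exact absurd (ht a (by simp)) (hr' a (by simp [← h]))
    | cons b t' =>
      simp only [List.cons_append, List.cons.injEq] at h
      obtain ⟨rfl, h⟩ := h
      obtain ⟨rfl, rfl⟩ := ih (fun a ha => ht a (by simp [ha])) (fun a ha => ht' a (by simp [ha])) h
      exact ⟨rfl, rfl⟩

def Symb.IsDigit (a : Symb) : Prop := a = .zero ∨ a = .one

theorem isDigit_of_mem_binNat {k : ℕ} {a : Symb} (h : a ∈ binNat k) : a.IsDigit := by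
  unfold binNat at h
  split_ifs at h
  · left; simpa using h
  · obtain ⟨d, -, rfl⟩ := List.mem_map.1 h
    cases d <;> simp [Symb.IsDigit]

/-- The natural number with the given binary expansion. -/
def natOfSymbs (s : List Symb) : ℕ :=
  (s.reverse.map fun a => decide (a = .one)).foldr Nat.bit 0

theorem foldr_bit_bits (n : ℕ) : n.bits.foldr Nat.bit 0 = n := by
  induction n using Nat.binaryRec' with
  | zero => simp
  | bit b n h ih => rw [Nat.bits_append_bit _ _ h, List.foldr_cons, ih]

theorem natOfSymbs_binNat (k : ℕ) : natOfSymbs (binNat k) = k := by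
  unfold binNat natOfSymbs
  split_ifs with h
  · subst h; decide
  · rw [← List.map_reverse, List.reverse_reverse, List.map_map]
    convert foldr_bit_bits k using 2
    conv_rhs => rw [← List.map_id k.bits]
    apply List.map_congr_left
    intro d _
    cases d <;> simp

theorem binNat_injective : Function.Injective binNat :=
  Function.LeftInverse.injective natOfSymbs_binNat

theorem binInt_injective : Function.Injective binInt := by
  intro y z h
  have key : ∀ x : ℤ, Symb.neg ∉ binNat x.natAbs := fun x hx => by
    rcases isDigit_of_mem_binNat hx with h | h <;> cases h
  unfold binInt at h
  split_ifs at h with hy hz hz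
  · have := binNat_injective (List.append_cancel_left h); omega
  · simp only [List.cons_append, List.nil_append] at h
    exact absurd (h ▸ List.mem_cons_self) (key z)
  · simp only [List.cons_append, List.nil_append] at h
    exact absurd (h ▸ List.mem_cons_self) (key y)
  · have := binNat_injective (List.append_cancel_left h); omega

theorem mem_binInt {z : ℤ} {a : Symb} (h : a ∈ binInt z) : a = .neg ∨ a.IsDigit := by
  unfold binInt at h
  rcases List.mem_append.1 h with h | h
  · split_ifs at h <;> simp_all
  · exact Or.inr (isDigit_of_mem_binNat h)

theorem length_binNat_le {k m : ℕ} (h : k < 2 ^ m) : (binNat k).length ≤ m + 1 := by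
  unfold binNat
  split_ifs
  · simp
  · simpa [Nat.size_eq_bits_len] using (Nat.size_le.2 h).trans (Nat.le_succ _)

theorem length_binInt_le {z : ℤ} {m : ℕ} (h : |z| < 2 ^ m) : (binInt z).length ≤ m + 2 := by
  have h' : z.natAbs < 2 ^ m := by zify; exact_mod_cast h
  have := length_binNat_le h'
  unfold binInt
  split_ifs <;> simp <;> omega

/-! ## Expansion of repetitions -/

theorem prefix_append_cases {α : Type*} {p A B : List α} (h : p <+: A ++ B) :
    p <+: A ∨ ∃ q, q <+: B ∧ p = A ++ q := by
  rcases List.prefix_or_prefix_of_prefix h (List.prefix_append A B) with h' | ⟨q, rfl⟩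
  · exact Or.inl h'
  · exact Or.inr ⟨q, (List.prefix_append_right_inj A).1 h, rfl⟩

/-- Balance is what locates the parenthesis that closes a repetition: the first prefix with an
excess of closing parentheses ends there. -/
theorem Expands.balanced {s t : List Symb} (h : Expands s t) :
    s.count .lpar = s.count .rpar ∧ ∀ p, p <+: s → p.count .rpar ≤ p.count .lpar := by
  induction h with
  | nil => simp
  | symb a s t h₁ h₂ h₃ h ih =>
    refine ⟨by simp [h₂, h₃, ih.1], fun p hp => ?_⟩
    cases p with
    | nil => simp
    | cons b p =>
      rw [List.cons_prefix_cons] at hp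
      obtain ⟨rfl, hp⟩ := hp
      simpa [List.count_cons, h₂, h₃] using ih.2 p hp
  | rep u v s t k hu hs h₀ h₁ ihu ihs =>
    have hl : (binNat k).count .lpar = 0 := List.count_eq_zero.2 fun h => by
      rcases isDigit_of_mem_binNat h with h | h <;> cases h
    have hr : (binNat k).count .rpar = 0 := List.count_eq_zero.2 fun h => by
      rcases isDigit_of_mem_binNat h with h | h <;> cases h
    refine ⟨by simp [hl, hr, ihu.1, ihs.1]; ring, fun p hp => ?_⟩
    have e : Symb.lpar :: u ++ .rpar :: .star :: binNat k ++ s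
        = (.lpar :: u) ++ ((.rpar :: .star :: binNat k) ++ s) := by simp
    rw [e] at hp
    have hu' := ihu.1
    rcases prefix_append_cases hp with hp' | ⟨q, hq, rfl⟩
    · cases p with
      | nil => simp
      | cons b p =>
        rw [List.cons_prefix_cons] at hp'
        obtain ⟨rfl, hp'⟩ := hp'
        have := ihu.2 p hp'
        simp
        omega
    · rcases prefix_append_cases hq with hq' | ⟨q, hq', rfl⟩
      · have := hq'.sublist.count_le Symb.rpar
        simp [hr] at this ⊢
        omega
      · have := ihs.2 q hq'
        simp [hl, hr]
        omega

theorem Expands.inv {s t : List Symb} (h : Expands s t) :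
    (s = [] ∧ t = []) ∨
    (∃ a s' t', a ≠ .lpar ∧ Expands s' t' ∧ s = a :: s' ∧ t = a :: t') ∨
    ∃ u v s' t' k, Expands u v ∧ Expands s' t' ∧ (∀ a, s'.head? = some a → ¬ a.IsDigit) ∧
      s = .lpar :: (u ++ .rpar :: (.star :: binNat k ++ s')) ∧
      t = (List.replicate k v).flatten ++ t' := by
  cases h with
  | nil => exact Or.inl ⟨rfl, rfl⟩
  | symb a s t h₁ h₂ h₃ h => exact Or.inr (Or.inl ⟨a, s, t, h₂, h, rfl, rfl⟩)
  | rep u v s t k hu hs h₀ h₁ =>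
    refine Or.inr (Or.inr ⟨u, v, s, t, k, hu, hs, ?_, by simp, rfl⟩)
    rintro a ha (rfl | rfl)
    exacts [h₀ ha, h₁ ha]

/-- The closing parenthesis of a repetition is determined by the sequence. -/
theorem Expands.append_rpar_inj {u v u' v' r r' : List Symb} (h : Expands u v) (h' : Expands u' v')
    (e : u ++ .rpar :: r = u' ++ .rpar :: r') : u = u' ∧ r = r' := by
  have key : ∀ {u v u' v' r r' : List Symb}, Expands u v → Expands u' v' →
      u ++ .rpar :: r = u' ++ .rpar :: r' → u' <+: u := by
    intro u v u' v' r r' h h' e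
    have hp : u' ++ [.rpar] <+: u ++ .rpar :: r := ⟨r', by simp [e]⟩
    rcases prefix_append_cases hp with hp | ⟨q, hq, e'⟩
    -- If `u'` followed by its closing parenthesis were a prefix of `u`, that prefix would close
    -- more parentheses than it opens.
    · have h1 := h.balanced.2 _ hp
      have h2 := h'.balanced.1
      simp at h1
      omega
    · have h3 : u <+: u' ++ [.rpar] := ⟨q, e'.symm⟩
      rcases prefix_append_cases h3 with h3 | ⟨q', hq', rfl⟩
      · rcases List.prefix_or_prefix_of_prefix (List.prefix_append u (.rpar :: r))
          (e ▸ List.prefix_append u' (.rpar :: r')) with h4 | h4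
        · obtain ⟨w, rfl⟩ := h4
          cases w with
          | nil => simp
          | cons b w =>
            simp only [List.append_assoc, List.append_cancel_left_eq, List.cons_append,
              List.cons.injEq] at e
            have h1 := h'.balanced.2 (u ++ [.rpar]) (by rw [← e.1]; exact ⟨w, by simp⟩)
            have h2 := h.balanced.1
            simp at h1
            omega
        · exact h4
      · exact List.prefix_append _ _
  obtain rfl : u = u' :=
    (key h' h e.symm).eq_of_length_le (key h h' e).length_le
  simpa using e

/-- Parsing is deterministic: balance determines the repeated word, and since no digit follows a
multiplicity, its digits are the maximal run after the star. -/
theorem Expands.unique {s t t' : List Symb} (h : Expands s t) (h' : Expands s t') : t = t' := by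
  induction h generalizing t' with
  | nil => rcases h'.inv with h | ⟨a, s', t', -, -, h, -⟩ | ⟨u, v, s', t', k, -, -, -, h, -⟩ <;> simp_all
  | symb a s t h₁ h₂ h₃ h ih =>
    rcases h'.inv with h | ⟨a, s', t', -, hs, h, rfl⟩ | ⟨u, v, s', t', k, -, -, -, h, -⟩
    · simp at h
    · simp only [List.cons.injEq] at h
      obtain ⟨rfl, rfl⟩ := h
      rw [ih hs]
    · simp only [List.cons.injEq] at h
      exact absurd h.1 h₂
  | rep u v s t k hu hs h₀ h₁ ihu ihs =>
    rcases h'.inv with h | ⟨a, s', t', ha, -, h, -⟩ | ⟨u', v', s', t', k', hu', hs', hh, h, rfl⟩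
    · simp at h
    · simp only [List.cons_append, List.cons.injEq] at h
      exact absurd h.1.symm ha
    · simp only [List.cons_append, List.append_assoc, List.cons.injEq, true_and] at h
      obtain ⟨rfl, h'⟩ := hu.append_rpar_inj hu' h
      simp only [List.cons.injEq, true_and] at h'
      obtain ⟨hk, rfl⟩ := append_inj_of_head Symb.IsDigit
        (fun a ha => isDigit_of_mem_binNat ha) (fun a ha => isDigit_of_mem_binNat ha)
        (by rintro a ha (rfl | rfl); exacts [h₀ ha, h₁ ha]) hh h'
      rw [binNat_injective hk, ihu hu', ihs hs']

theorem Expands.refl_of_plain {t : List Symb}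
    (h : ∀ a ∈ t, a ≠ .star ∧ a ≠ .lpar ∧ a ≠ .rpar) : Expands t t := by
  induction t with
  | nil => exact .nil
  | cons a t ih =>
    obtain ⟨h₁, h₂, h₃⟩ := h a (by simp)
    exact .symb a t t h₁ h₂ h₃ (ih fun b hb => h b (by simp [hb]))

/-- If `s` ends with a multiplicity, a digit at the head of `s'` would be read as part of it; `hs'`
excludes this. -/
theorem Expands.append {s t s' t' : List Symb} (h : Expands s t) (h' : Expands s' t')
    (hs' : ∀ a, s'.head? = some a → ¬ a.IsDigit) : Expands (s ++ s') (t ++ t') := by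
  have hd : s'.head? ≠ some .zero ∧ s'.head? ≠ some .one :=
    ⟨fun h => hs' _ h (Or.inl rfl), fun h => hs' _ h (Or.inr rfl)⟩
  induction h with
  | nil => simpa
  | symb a s t h₁ h₂ h₃ h ih => exact .symb a _ _ h₁ h₂ h₃ ih
  | rep u v s t k hu hs h₀ h₁ ihu ihs =>
    have := Expands.rep u v (s ++ s') (t ++ t') k hu ihs
      (by cases s <;> simp_all) (by cases s <;> simp_all)
    simpa using this

theorem Expands.repeat {u v : List Symb} (h : Expands u v) (k : ℕ) :
    Expands (.lpar :: u ++ .rpar :: .star :: binNat k) (List.replicate k v).flatten := by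
  simpa using Expands.rep u v [] [] k h .nil (by simp) (by simp)

/-! ## Injectivity of the encoding -/

/-- The tokens, each preceded by a comma. -/
def joinTokens (ts : List (List Symb)) : List Symb := ts.flatMap (.comma :: ·)

theorem joinTokens_append (ts us : List (List Symb)) :
    joinTokens (ts ++ us) = joinTokens ts ++ joinTokens us := by simp [joinTokens]

theorem joinTokens_cons (t : List Symb) (ts : List (List Symb)) :
    joinTokens (t :: ts) = .comma :: (t ++ joinTokens ts) := by simp [joinTokens]

/-- A leading comma makes the encoding multiplicative in the list of tokens. Descriptions are
therefore built with it, and `Expands.tail_of_comma` removes it at the end. -/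
theorem comma_cons_intercalate {ts : List (List Symb)} (h : ts ≠ []) :
    Symb.comma :: List.intercalate [.comma] ts = joinTokens ts := by
  induction ts with
  | nil => exact absurd rfl h
  | cons t ts ih =>
    cases ts with
    | nil => simp [joinTokens]
    | cons u ts =>
      rw [joinTokens_cons, ← ih (by simp), List.intercalate_cons_cons]
      simp

theorem joinTokens_head (ts : List (List Symb)) (a : Symb)
    (h : (joinTokens ts).head? = some a) : a = .comma := by
  cases ts with
  | nil => simp [joinTokens] at h
  | cons t ts => simpa [joinTokens_cons] using h.symm

theorem joinTokens_injOn {ts us : List (List Symb)} (ht : ∀ t ∈ ts, Symb.comma ∉ t)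
    (hu : ∀ u ∈ us, Symb.comma ∉ u) (h : joinTokens ts = joinTokens us) : ts = us := by
  induction ts generalizing us with
  | nil =>
    cases us with
    | nil => rfl
    | cons u us => simp [joinTokens] at h
  | cons t ts ih =>
    cases us with
    | nil => simp [joinTokens] at h
    | cons u us =>
      simp only [joinTokens_cons, List.cons.injEq, true_and] at h
      obtain ⟨rfl, h⟩ := append_inj_of_head (· ≠ Symb.comma)
        (fun a ha e => ht t (by simp) (e ▸ ha)) (fun a ha e => hu u (by simp) (e ▸ ha))
        (fun a ha => by simpa using joinTokens_head _ _ ha)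
        (fun a ha => by simpa using joinTokens_head _ _ ha) h
      rw [ih (fun t ht' => ht t (List.mem_cons_of_mem _ ht'))
        (fun u hu' => hu u (List.mem_cons_of_mem _ hu')) ‹_›]

/-- The tokens of a network. -/
def Network.tokens {I : ℕ} (F : Network I) : List (List Symb) :=
  F.spec.map (fun o => match o with | none => [.inp] | some c => binInt c) ++ F.layers.tokens

/-- A symbol that can occur in a token. -/
def Symb.IsPlain (a : Symb) : Prop := a ≠ .comma ∧ a ≠ .star ∧ a ≠ .lpar ∧ a ≠ .rpar

theorem isPlain_of_mem_binInt {z : ℤ} {a : Symb} (h : a ∈ binInt z) : a.IsPlain := by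
  rcases mem_binInt h with rfl | rfl | rfl <;> simp [Symb.IsPlain]

theorem Layer.isPlain {n m : ℕ} (l : Layer n m) : ∀ t ∈ l.tokens, ∀ a ∈ t, a.IsPlain := by
  intro t ht a ha
  simp only [Layer.tokens, List.cons_append, List.mem_cons, List.mem_append, List.mem_flatten,
    List.mem_ofFn] at ht
  rcases ht with rfl | ⟨r, ⟨i, rfl⟩, hr⟩ | rfl | ⟨i, rfl⟩
  · simp only [List.mem_singleton] at ha
    subst ha; simp [Symb.IsPlain]
  · obtain ⟨j, rfl⟩ := (List.mem_ofFn' _ _).1 hr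
    exact isPlain_of_mem_binInt ha
  · simp only [List.mem_singleton] at ha
    subst ha; simp [Symb.IsPlain]
  · exact isPlain_of_mem_binInt ha

theorem Layers.isPlain : ∀ {n : ℕ} (l : Layers n), ∀ t ∈ l.tokens, ∀ a ∈ t, a.IsPlain
  | _, .out l => l.isPlain
  | _, .hidden l rest => fun t ht => by
      rcases List.mem_append.1 ht with h | h
      · exact l.isPlain t h
      · exact rest.isPlain t h

theorem Network.isPlain {I : ℕ} (F : Network I) : ∀ t ∈ F.tokens, ∀ a ∈ t, a.IsPlain := by
  intro t ht a ha
  rcases List.mem_append.1 ht with h | h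
  · obtain ⟨o, -, rfl⟩ := List.mem_map.1 h
    cases o with
    | none =>
      simp only [List.mem_singleton] at ha
      subst ha; simp [Symb.IsPlain]
    | some c => exact isPlain_of_mem_binInt ha
  · exact F.layers.isPlain t h a ha

theorem Layers.tokens_head {n : ℕ} (l : Layers n) : l.tokens.head? = some [.weight] := by
  cases l <;> simp [Layers.tokens, Layer.tokens]

theorem Network.comma_cons_encoding {I : ℕ} (F : Network I) :
    Symb.comma :: F.encoding = joinTokens F.tokens :=
  comma_cons_intercalate fun h => by
    have := F.layers.tokens_head
    simp_all

theorem binInt_ne_weight (z : ℤ) : binInt z ≠ [.weight] := fun h => by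
  rcases mem_binInt (h ▸ List.mem_singleton_self _) with h | h | h <;> cases h

theorem binInt_ne_bias (z : ℤ) : binInt z ≠ [.bias] := fun h => by
  rcases mem_binInt (h ▸ List.mem_singleton_self _) with h | h | h <;> cases h

/-- The tokens of a layer, followed by tokens that are empty or start with a weight marker,
determine the layer. -/
theorem Layer.tokens_append_inj {n m m' : ℕ} (l : Layer n m) (l' : Layer n m')
    {r r' : List (List Symb)} (hr : ∀ t, r.head? = some t → t = [.weight])
    (hr' : ∀ t, r'.head? = some t → t = [.weight]) (h : l.tokens ++ r = l'.tokens ++ r') :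
    m = m' ∧ HEq l l' ∧ r = r' := by
  simp only [Layer.tokens, List.cons_append, List.append_assoc, List.cons.injEq, true_and] at h
  have hW : ∀ {m : ℕ} (l : Layer n m), ∀ t ∈ (List.ofFn fun i => List.ofFn fun j =>
      binInt (l.W i j)).flatten, t ≠ [.bias] := by
    intro m l t ht
    simp only [List.mem_flatten, List.mem_ofFn] at ht
    obtain ⟨r, ⟨i, rfl⟩, hr⟩ := ht
    obtain ⟨j, rfl⟩ := (List.mem_ofFn' _ _).1 hr
    exact binInt_ne_bias _
  have hb : ∀ {m : ℕ} (l : Layer n m), ∀ t ∈ List.ofFn fun i => binInt (l.b i),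
      t ≠ [.weight] := by
    intro m l t ht
    obtain ⟨j, rfl⟩ := (List.mem_ofFn' _ _).1 ht
    exact binInt_ne_weight _
  obtain ⟨h₁, h⟩ := append_inj_of_head (· ≠ [Symb.bias]) (hW l) (hW l') (by simp) (by simp) h
  simp only [List.cons.injEq, true_and] at h
  obtain ⟨h₂, hrr⟩ := append_inj_of_head (· ≠ [Symb.weight]) (hb l) (hb l')
    (fun t ht => by simpa using hr t ht) (fun t ht => by simpa using hr' t ht) h
  have hm : m = m' := by simpa using congrArg List.length h₂
  subst hm
  refine ⟨rfl, heq_of_eq ?_, hrr⟩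
  have e₂ : l.b = l'.b := by
    funext i
    exact binInt_injective (congrFun (List.ofFn_injective h₂) i)
  have e₁ : l.W = l'.W := by
    -- The height was read off the biases, and all rows have the known length `n`, so the flattened
    -- matrix can be cut into rows.
    have := List.ofFn_injective (List.eq_iff_flatten_eq.2 ⟨h₁, by simp [List.map_ofFn,
      Function.comp_def]⟩)
    ext i j
    exact binInt_injective (congrFun (List.ofFn_injective (congrFun this i)) j)
  cases l; cases l'; simp_all

/-- The output width recovered from one layer is the input width of the next; a further weight
marker tells a hidden layer from the last one. -/
theorem Layers.tokens_injective : ∀ {n : ℕ} (l l' : Layers n), l.tokens = l'.tokens → l = l'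
  | _, .out l, .out l', h => by
      obtain ⟨-, h, -⟩ := l.tokens_append_inj l' (r := []) (r' := []) (by simp) (by simp)
        (by simpa [Layers.tokens] using h)
      rw [eq_of_heq h]
  | _, .out l, .hidden l' r, h => by
      obtain ⟨-, -, h⟩ := l.tokens_append_inj l' (r := []) (r' := r.tokens) (by simp)
        (by simp [r.tokens_head]) (by simpa [Layers.tokens] using h)
      simpa [← h] using r.tokens_head
  | _, .hidden l r, .out l', h => by
      obtain ⟨-, -, h⟩ := l.tokens_append_inj l' (r := r.tokens) (r' := [])
        (by simp [r.tokens_head]) (by simp) (by simpa [Layers.tokens] using h)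
      simpa [h] using r.tokens_head
  | _, .hidden l r, .hidden l' r', h => by
      obtain ⟨rfl, h, hr⟩ := l.tokens_append_inj l' (r := r.tokens) (r' := r'.tokens)
        (by simp [r.tokens_head]) (by simp [r'.tokens_head]) (by simpa [Layers.tokens] using h)
      rw [eq_of_heq h, r.tokens_injective r' hr]

/-- The tokens before the first weight marker are the input coordinates, and their number is the
input width of the first layer. -/
theorem Network.encoding_injective {I : ℕ} :
    Function.Injective (Network.encoding : Network I → List Symb) := by
  intro F G h
  have h : F.tokens = G.tokens := by
    apply joinTokens_injOn (fun t ht hc => (F.isPlain t ht _ hc).1 rfl)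
      (fun t ht hc => (G.isPlain t ht _ hc).1 rfl)
    rw [← F.comma_cons_encoding, ← G.comma_cons_encoding, h]
  obtain ⟨s, hs, l⟩ := F
  obtain ⟨s', hs', l'⟩ := G
  have hw : ∀ s : List (Option ℤ), ∀ t ∈ s.map (fun o => match o with
      | none => [.inp] | some c => binInt c), t ≠ [Symb.weight] := by
    intro s t ht
    obtain ⟨o, -, rfl⟩ := List.mem_map.1 ht
    cases o with
    | none => simp
    | some c => exact binInt_ne_weight c
  obtain ⟨h₁, h₂⟩ := append_inj_of_head (· ≠ [Symb.weight]) (hw s) (hw s')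
    (by simp [Layers.tokens_head]) (by simp [Layers.tokens_head]) h
  obtain rfl : s = s' := by
    refine List.map_injective_iff.2 ?_ h₁
    intro o o' h
    have hi : ∀ z, binInt z ≠ [.inp] := fun z h => by
      rcases mem_binInt (h ▸ List.mem_singleton_self _) with h | h | h <;> cases h
    cases o <;> cases o' <;> simp only [Option.some.injEq] at h ⊢
    · exact absurd h.symm (hi _)
    · exact absurd h (hi _)
    · exact binInt_injective h
  rw [Layers.tokens_injective l l' h₂]

/-! ## Counting networks -/

theorem Network.exists_expands {I : ℕ} (F : Network I) :
    ∃ s, Expands s F.encoding ∧ s.length = F.descLength := by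
  refine Nat.sInf_mem (s := {k | ∃ s : List Symb, Expands s F.encoding ∧ s.length = k})
    ⟨_, F.encoding, .refl_of_plain ?_, rfl⟩
  intro a ha
  have : a ∈ joinTokens F.tokens := F.comma_cons_encoding ▸ List.mem_cons_of_mem _ ha
  obtain ⟨t, ht, hat⟩ := List.mem_flatMap.1 this
  rcases List.mem_cons.1 hat with rfl | hat
  · simp
  · exact (F.isPlain t ht a hat).2

theorem Network.descLength_le {I : ℕ} (F : Network I) {s : List Symb}
    (h : Expands s F.encoding) : F.descLength ≤ s.length := Nat.sInf_le ⟨s, h, rfl⟩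

/-- A shortest description determines the network, by uniqueness of expansions and injectivity of
the encoding. Padding it to length `D` by a blank gives a word over eleven letters. -/
theorem exists_finset_descLength_le (I D : ℕ) :
    ∃ S : Finset (Network I), (∀ F, F.descLength ≤ D → F ∈ S) ∧ S.card ≤ 11 ^ D := by
  choose str hstr hlen using fun F : Network I => F.exists_expands
  let g : {F : Network I // F.descLength ≤ D} → (Fin D → Option Symb) := fun F i => (str F.1)[i]?
  have hg : Function.Injective g := by
    intro F G h
    have : str F.1 = str G.1 := by
      apply List.ext_getElem?
      intro i
      by_cases hi : i < D
      · exact congrFun h ⟨i, hi⟩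
      · rw [List.getElem?_eq_none, List.getElem?_eq_none] <;> rw [hlen]
        · have := G.2; omega
        · have := F.2; omega
    exact Subtype.ext (Network.encoding_injective ((hstr F.1).unique (this ▸ hstr G.1)))
  have := Fintype.ofInjective g hg
  refine ⟨(Finset.univ : Finset {F : Network I // F.descLength ≤ D}).map
    (Function.Embedding.subtype _), fun F hF => by simpa using hF, ?_⟩
  rw [Finset.card_map, Finset.card_univ]
  refine (Fintype.card_le_of_injective g hg).trans ?_
  simp [card_symb]

/-! ## Integer affine forms and layers -/

/-- An affine form with integer coefficients. -/
structure Aff (ι : Type) where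
  coef : ι → ℤ
  const : ℤ

namespace Aff

variable {ι : Type}

instance : Add (Aff ι) := ⟨fun A A' => ⟨A.coef + A'.coef, A.const + A'.const⟩⟩
instance : Sub (Aff ι) := ⟨fun A A' => ⟨A.coef - A'.coef, A.const - A'.const⟩⟩
instance : SMul ℤ (Aff ι) := ⟨fun c A => ⟨fun i => c * A.coef i, c * A.const⟩⟩

def coord [DecidableEq ι] (i : ι) : Aff ι := ⟨Pi.single i 1, 0⟩

def constant (c : ℤ) : Aff ι := ⟨0, c⟩

def eval [Fintype ι] (A : Aff ι) (s : ι → ℤ) : ℤ := ∑ i, A.coef i * s i + A.const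

section eval
variable [Fintype ι] (s : ι → ℤ)

@[simp] theorem eval_coord [DecidableEq ι] (i : ι) : (coord i).eval s = s i := by
  simp [coord, eval, Pi.single_apply]

@[simp] theorem eval_constant (c : ℤ) : (constant c).eval s = c := by
  simp [constant, eval]

@[simp] theorem eval_add (A A' : Aff ι) : (A + A').eval s = A.eval s + A'.eval s := by
  change ∑ i, (A.coef i + A'.coef i) * s i + (A.const + A'.const) = _
  simp only [eval, add_mul, Finset.sum_add_distrib]
  ring

@[simp] theorem eval_sub (A A' : Aff ι) : (A - A').eval s = A.eval s - A'.eval s := by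
  change ∑ i, (A.coef i - A'.coef i) * s i + (A.const - A'.const) = _
  simp only [eval, sub_mul, Finset.sum_sub_distrib]
  ring

@[simp] theorem eval_smul (c : ℤ) (A : Aff ι) : (c • A).eval s = c * A.eval s := by
  change ∑ i, (c * A.coef i) * s i + c * A.const = _
  simp only [eval, mul_add, Finset.mul_sum, mul_assoc]

end eval

/-- All coefficients are at most `M` in absolute value. -/
def Bounded (A : Aff ι) (M : ℤ) : Prop := (∀ i, |A.coef i| ≤ M) ∧ |A.const| ≤ M

theorem Bounded.mono {A : Aff ι} {M M' : ℤ} (h : A.Bounded M) (hM : M ≤ M') : A.Bounded M' :=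
  ⟨fun i => (h.1 i).trans hM, h.2.trans hM⟩

theorem Bounded.add {A A' : Aff ι} {M M' : ℤ} (h : A.Bounded M) (h' : A'.Bounded M') :
    (A + A').Bounded (M + M') :=
  ⟨fun i => (abs_add_le _ _).trans (add_le_add (h.1 i) (h'.1 i)),
    (abs_add_le _ _).trans (add_le_add h.2 h'.2)⟩

theorem Bounded.sub {A A' : Aff ι} {M M' : ℤ} (h : A.Bounded M) (h' : A'.Bounded M') :
    (A - A').Bounded (M + M') :=
  ⟨fun i => (abs_sub _ _).trans (add_le_add (h.1 i) (h'.1 i)),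
    (abs_sub _ _).trans (add_le_add h.2 h'.2)⟩

theorem Bounded.smul {A : Aff ι} {M c : ℤ} (hc : 0 ≤ c) (h : A.Bounded M) :
    (c • A).Bounded (c * M) := by
  refine ⟨fun i => ?_, ?_⟩
  · change |c * A.coef i| ≤ _
    rw [abs_mul, abs_of_nonneg hc]
    exact mul_le_mul_of_nonneg_left (h.1 i) hc
  · change |c * A.const| ≤ _
    rw [abs_mul, abs_of_nonneg hc]
    exact mul_le_mul_of_nonneg_left h.2 hc

theorem bounded_coord [DecidableEq ι] (i : ι) : (coord i).Bounded 1 := by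
  refine ⟨fun j => ?_, by simp [coord]⟩
  simp only [coord, Pi.single_apply]
  split_ifs <;> simp

theorem bounded_constant (c : ℤ) : (constant c : Aff ι).Bounded |c| :=
  ⟨fun i => by simp [constant], le_rfl⟩

end Aff

/-- The vector listing the values of an integer-valued function in a given order. -/
def encode {ι : Type} {n : ℕ} (e : ι ≃ Fin n) (s : ι → ℤ) : Fin n → ℝ := fun p => (s (e.symm p) : ℝ)

/-- The layer computing a family of affine forms. -/
def Layer.ofAff {ι κ : Type} {n m : ℕ} (e : ι ≃ Fin n) (e' : κ ≃ Fin m) (A : κ → Aff ι) :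
    Layer n m :=
  ⟨fun p q => (A (e'.symm p)).coef (e.symm q), fun p => (A (e'.symm p)).const⟩

theorem Layer.eval_ofAff {ι κ : Type} [Fintype ι] {n m : ℕ} (e : ι ≃ Fin n) (e' : κ ≃ Fin m)
    (A : κ → Aff ι) (s : ι → ℤ) :
    (Layer.ofAff e e' A).eval (encode e s) = encode e' fun k => (A k).eval s := by
  funext p
  simp only [Layer.eval, Layer.ofAff, encode, Aff.eval, Int.cast_add, Int.cast_sum, Int.cast_mul]
  congr 1
  exact Equiv.sum_comp e.symm fun i => ((A (e'.symm p)).coef i : ℝ) * (s i : ℝ)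

theorem Layers.eval_hidden_ofAff {ι κ : Type} [Fintype ι] {n m : ℕ} (e : ι ≃ Fin n)
    (e' : κ ≃ Fin m) (A : κ → Aff ι) (R : Layers m) (s : ι → ℤ) :
    (Layers.hidden (.ofAff e e' A) R).eval (encode e s)
      = R.eval (encode e' fun k => max ((A k).eval s) 0) := by
  rw [Layers.eval, Layer.eval_ofAff]
  congr 1
  funext p
  simp [encode]

theorem length_joinTokens (ts : List (List Symb)) :
    (joinTokens ts).length = (ts.map fun t => t.length + 1).sum := by
  induction ts with
  | nil => rfl
  | cons t ts ih => simp [joinTokens_cons, ih]; ring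

theorem Layer.length_joinTokens {n m : ℕ} (l : Layer n m) :
    (joinTokens l.tokens).length
      = 4 + ∑ p, (∑ q, ((binInt (l.W p q)).length + 1) + ((binInt (l.b p)).length + 1)) := by
  rw [_root_.length_joinTokens, Layer.tokens]
  simp only [List.map_append, List.map_cons, List.map_flatten, List.map_ofFn, List.sum_append,
    List.sum_cons, List.sum_flatten, Function.comp_def, List.sum_ofFn, Finset.sum_add_distrib,
    List.length_singleton]
  ring

/-- The two markers with their commas take 4 symbols; an entry takes a comma, possibly a sign, and
at most `β k + 1` digits. -/
theorem Layer.length_ofAff_le {ι κ : Type} [Fintype ι] [Fintype κ] {n m : ℕ} (e : ι ≃ Fin n)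
    (e' : κ ≃ Fin m) (A : κ → Aff ι) (β : κ → ℕ) (hβ : ∀ k, (A k).Bounded (2 ^ β k - 1)) :
    (joinTokens (Layer.ofAff e e' A).tokens).length
      ≤ 4 + ∑ k, (Fintype.card ι + 1) * (β k + 3) := by
  rw [Layer.length_joinTokens, ← Equiv.sum_comp e'.symm, Fintype.card_congr e, Fintype.card_fin]
  gcongr with p
  have hc := length_binInt_le (Int.lt_of_le_sub_one (hβ (e'.symm p)).2)
  calc _ ≤ ∑ q : Fin n, (β (e'.symm p) + 3) + (β (e'.symm p) + 3) := by
        exact add_le_add (Finset.sum_le_sum fun q _ => Nat.succ_le_succ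
          (length_binInt_le (Int.lt_of_le_sub_one ((hβ (e'.symm p)).1 (e.symm q)))))
          (Nat.succ_le_succ hc)
    _ = _ := by simp; ring

/-! ## Relations realized by sequences of layers -/

/-- Some sequence of hidden layers, described by at most `m` symbols, maps `x` to `y` whenever
`rel x y` holds. -/
def Realizes {ι κ : Type} [Fintype ι] [Fintype κ] (rel : (ι → ℤ) → (κ → ℤ) → Prop) (m : ℕ) :
    Prop :=
  ∃ (f : Layers (Fintype.card κ) → Layers (Fintype.card ι)) (ts : List (List Symb))
    (s : List Symb),
    (∀ R, (f R).tokens = ts ++ R.tokens) ∧ Expands s (joinTokens ts) ∧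
    (∀ a, s.head? = some a → ¬ a.IsDigit) ∧ s.length ≤ m ∧
    ∀ x y, rel x y → ∀ R, (f R).eval (encode (Fintype.equivFin ι) x)
      = R.eval (encode (Fintype.equivFin κ) y)

theorem expands_joinTokens {ts : List (List Symb)} (h : ∀ t ∈ ts, ∀ a ∈ t, a.IsPlain) :
    Expands (joinTokens ts) (joinTokens ts) := by
  refine .refl_of_plain fun a ha => ?_
  obtain ⟨t, ht, hat⟩ := List.mem_flatMap.1 ha
  rcases List.mem_cons.1 hat with rfl | hat
  · simp
  · exact (h t ht a hat).2

theorem not_isDigit_joinTokens_head (ts : List (List Symb)) (a : Symb)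
    (h : (joinTokens ts).head? = some a) : ¬ a.IsDigit := by
  rw [joinTokens_head ts a h]
  rintro (h | h) <;> cases h

namespace Realizes

variable {ι κ τ : Type} [Fintype ι] [Fintype κ] [Fintype τ]

theorem mono {r r' : (ι → ℤ) → (κ → ℤ) → Prop} {m m' : ℕ} (h : Realizes r m)
    (hr : ∀ x y, r' x y → r x y) (hm : m ≤ m') : Realizes r' m' := by
  obtain ⟨f, ts, s, h₁, h₂, h₃, h₄, h₅⟩ := h
  exact ⟨f, ts, s, h₁, h₂, h₃, h₄.trans hm, fun x y hxy => h₅ x y (hr x y hxy)⟩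

theorem refl : Realizes (fun x y : ι → ℤ => x = y) 0 :=
  ⟨id, [], [], by simp, .nil, by simp, by simp, by rintro x _ rfl R; rfl⟩

theorem comp {r : (ι → ℤ) → (κ → ℤ) → Prop} {r' : (κ → ℤ) → (τ → ℤ) → Prop} {m m' : ℕ}
    (h : Realizes r m) (h' : Realizes r' m') : Realizes (Relation.Comp r r') (m + m') := by
  obtain ⟨f, ts, s, h₁, h₂, h₃, h₄, h₅⟩ := h
  obtain ⟨f', ts', s', h₁', h₂', h₃', h₄', h₅'⟩ := h'
  refine ⟨f ∘ f', ts ++ ts', s ++ s', by simp [h₁, h₁'], ?_, ?_, ?_, ?_⟩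
  · rw [joinTokens_append]
    exact h₂.append h₂' h₃'
  · cases s with
    | nil => simpa using h₃'
    | cons a s => simpa using h₃
  · simp; omega
  · rintro x z ⟨y, hy, hz⟩ R
    rw [Function.comp_apply, h₅ x y hy, h₅' y z hz]

/-- The layers are copied `k` times but described once, with two parentheses, a star and the digits
of `k`. This keeps loops cheap. -/
theorem iterate {r : (ι → ℤ) → (ι → ℤ) → Prop} {m : ℕ} (h : Realizes r m) (k : ℕ) :
    Realizes (fun x y => ∃ u : ℕ → ι → ℤ, u 0 = x ∧ u k = y ∧ ∀ i < k, r (u i) (u (i + 1)))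
      (m + 3 + (binNat k).length) := by
  obtain ⟨f, ts, s, h₁, h₂, h₃, h₄, h₅⟩ := h
  refine ⟨f^[k], (List.replicate k ts).flatten, .lpar :: s ++ .rpar :: .star :: binNat k,
    ?_, ?_, ?_, ?_, ?_⟩
  · intro R
    clear h₅
    induction k with
    | zero => simp
    | succ k ih => rw [Function.iterate_succ_apply', h₁, ih, List.replicate_succ]; simp
  · convert h₂.repeat k using 1
    clear h₅
    induction k with
    | zero => simp [joinTokens]
    | succ k ih => simp [List.replicate_succ, joinTokens_append, ih]
  · rintro a ha
    simp only [List.cons_append, List.head?_cons, Option.some.injEq] at ha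
    subst ha
    rintro (h | h) <;> cases h
  · simp; omega
  · rintro x y ⟨u, rfl, rfl, hu⟩ R
    clear h₂
    induction k generalizing R with
    | zero => rfl
    | succ k ih =>
      rw [Function.iterate_succ_apply, ih (fun i hi => hu i (by omega)), h₅ _ _ (hu k (by omega))]

theorem layer (A : κ → Aff ι) (β : κ → ℕ) (hβ : ∀ k, (A k).Bounded (2 ^ β k - 1)) :
    Realizes (fun x y => y = fun k => max ((A k).eval x) 0)
      (4 + ∑ k, (Fintype.card ι + 1) * (β k + 3)) := by
  refine ⟨fun R => .hidden (.ofAff (Fintype.equivFin ι) (Fintype.equivFin κ) A) R, _, _,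
    fun R => rfl, expands_joinTokens (Layer.isPlain _), not_isDigit_joinTokens_head _,
    Layer.length_ofAff_le _ _ A β hβ, ?_⟩
  rintro x _ rfl R
  exact Layers.eval_hidden_ofAff _ _ A R x

/-- Two layers that add a combination of rectified affine forms to the state. -/
theorem update [DecidableEq ι] (l : List (Aff ι × (ι → ℤ))) (c : ι → ℤ) (r β : ℕ)
    (hr : l.length ≤ r) (hβ : 0 < β) (hl : ∀ t ∈ l, t.1.Bounded (2 ^ β - 1) ∧
      ∀ i, |t.2 i| ≤ 2 ^ β - 1) (hc : ∀ i, |c i| ≤ 2 ^ β - 1) :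
    Realizes (fun x y : ι → ℤ => (∀ i, 0 ≤ x i) ∧ (∀ i, 0 ≤ y i) ∧
        ∀ i, y i = x i + c i + (l.map fun t => t.2 i * max (t.1.eval x) 0).sum)
      (8 + 2 * (Fintype.card ι + r + 1) ^ 2 * (β + 3)) := by
  have h1 : (1 : ℤ) ≤ 2 ^ β - 1 := by
    have : (2 : ℤ) ^ 1 ≤ 2 ^ β := pow_le_pow_right₀ (by norm_num) hβ
    linarith
  -- The first layer copies the state, which rectification preserves because it is nonnegative, and
  -- evaluates the forms; the second layer, `A'`, combines them.
  let A : ι ⊕ Fin l.length → Aff ι := Sum.elim Aff.coord fun j => l[j].1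
  let A' : ι → Aff (ι ⊕ Fin l.length) := fun i =>
    ⟨Sum.elim (Pi.single i 1) fun j => l[j].2 i, c i⟩
  refine ((layer A (fun _ => β) ?_).comp (layer A' (fun _ => β) ?_)).mono ?_ ?_
  · rintro (i | j)
    · exact (Aff.bounded_coord i).mono h1
    · exact (hl _ (List.getElem_mem _)).1
  · intro i
    refine ⟨?_, hc i⟩
    rintro (j | j)
    · exact ((Aff.bounded_coord i).1 j).trans h1
    · exact (hl _ (List.getElem_mem _)).2 i
  · rintro x y ⟨hx, hy, h⟩
    refine ⟨_, rfl, ?_⟩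
    funext i
    have : (A' i).eval (fun k => max ((A k).eval x) 0) = y i := by
      rw [h i, ← Fin.sum_univ_fun_getElem]
      simp only [Aff.eval, A', A, Fintype.sum_sum_type, Sum.elim_inl, Sum.elim_inr]
      have e : ∑ j, (Pi.single i 1 : ι → ℤ) j * max ((Aff.coord j).eval x) 0 = x i := by
        simp [Pi.single_apply, hx]
      simp only [Aff.eval] at e
      rw [e]
      simp only [Fin.getElem_fin]
      ring
    rw [this, max_eq_left (hy i)]
  · simp only [Finset.sum_const, Finset.card_univ, Fintype.card_sum, Fintype.card_fin,
      smul_eq_mul]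
    have e₁ : (Fintype.card ι + l.length) * (Fintype.card ι + 1)
        ≤ (Fintype.card ι + r + 1) ^ 2 := by
      rw [sq]; exact Nat.mul_le_mul (by omega) (by omega)
    have e₂ : Fintype.card ι * (Fintype.card ι + l.length + 1)
        ≤ (Fintype.card ι + r + 1) ^ 2 := by
      rw [sq]; exact Nat.mul_le_mul (by omega) (by omega)
    nlinarith [Nat.mul_le_mul_right (β + 3) e₁, Nat.mul_le_mul_right (β + 3) e₂]

end Realizes

section

/-! ## Instructions as updates -/

variable {I J : ℕ}

/-- The affine form of an operand. -/
def Operand.aff : Operand I J → Aff (Var I J)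
  | .const c => .constant c
  | .var v => .coord v

@[simp] theorem Operand.eval_aff (a : Operand I J) (σ : State I J) : a.aff.eval σ = a.val σ := by
  cases a <;> simp [Operand.aff, Operand.val]

/-- The value of a combination of rectified affine forms. -/
def evalTerms (l : List (Aff (Var I J) × ℤ)) (σ : State I J) : ℤ :=
  (l.map fun t => t.2 * max (t.1.eval σ) 0).sum

/-- The truth value of `u ≥ v`. -/
def geTerms (u v : Aff (Var I J)) : List (Aff (Var I J) × ℤ) :=
  [(u - v + .constant 1, 1), (u - v, -1)]

/-- The truth value of a comparison. -/
def Cmp.terms (u v : Aff (Var I J)) : Cmp → List (Aff (Var I J) × ℤ)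
  | .eq => geTerms u v ++ geTerms v u ++ [(.constant 1, -1)]
  | .lt => geTerms v (u + .constant 1)
  | .le => geTerms v u
  | .gt => geTerms u (v + .constant 1)
  | .ge => geTerms u v

/-- The value of `a` if `b` is `1`, and `0` otherwise, for values in `{0, ..., B}`, times `c`. -/
def selectTerms (B : ℤ) (c : ℤ) (a b : Aff (Var I J)) : List (Aff (Var I J) × ℤ) :=
  [(a - B • b + .constant B, c), (.constant 1 - b, - c * B), (a - B • b, - c)]

/-- The value assigned by an instruction. -/
def Instr.terms (B : ℕ) : Instr I J → List (Aff (Var I J) × ℤ)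
  | .assign _ a => [(a.aff, 1)]
  | .cond _ b a a' =>
      selectTerms B 1 a.aff (.coord b) ++ (a'.aff, 1) :: selectTerms B (-1) a'.aff (.coord b)
  | .addConst _ y c => [(.coord y + .constant c, 1)]
  | .mulConst _ c y => [((c : ℤ) • .coord y, 1)]
  | .cmpConst _ r y c => r.terms (.coord y) (.constant c)
  | .add _ y z => [(.coord y + .coord z, 1)]
  | .sub _ y z => [(.coord y - .coord z, 1)]
  | .cmpVar _ r y z => r.terms (.coord y) (.coord z)

/-- For an integer d, max(d + 1, 0) - max(d, 0) is 1 if d ≥ 0 and 0 otherwise. -/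
theorem evalTerms_geTerms (u v : Aff (Var I J)) (σ : State I J) :
    evalTerms (geTerms u v) σ = if u.eval σ ≥ v.eval σ then 1 else 0 := by
  simp only [evalTerms, geTerms, List.map_cons, List.map_nil, List.sum_cons, List.sum_nil,
    Aff.eval_add, Aff.eval_sub, Aff.eval_constant]
  split_ifs <;> omega

theorem evalTerms_append (l l' : List (Aff (Var I J) × ℤ)) (σ : State I J) :
    evalTerms (l ++ l') σ = evalTerms l σ + evalTerms l' σ := by simp [evalTerms]

theorem evalTerms_cons (t : Aff (Var I J) × ℤ) (l : List (Aff (Var I J) × ℤ)) (σ : State I J) :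
    evalTerms (t :: l) σ = t.2 * max (t.1.eval σ) 0 + evalTerms l σ := by simp [evalTerms]

@[simp] theorem evalTerms_nil (σ : State I J) :
    evalTerms ([] : List (Aff (Var I J) × ℤ)) σ = 0 := rfl

/-- Over the integers a strict inequality is a weak one shifted by 1, and equality is the sum of the
two weak inequalities minus 1. -/
theorem evalTerms_cmp (r : Cmp) (u v : Aff (Var I J)) (σ : State I J) :
    evalTerms (r.terms u v) σ = r.val (u.eval σ) (v.eval σ) := by
  cases r <;>
    simp only [Cmp.terms, Cmp.val, evalTerms_append, evalTerms_geTerms, evalTerms_cons,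
      evalTerms_nil, Aff.eval_add, Aff.eval_constant] <;>
    split_ifs <;> omega

/-- At b = 1 only the first form survives and equals a; at b = 0 the three contributions cancel; for
b ≥ 2 all forms are nonpositive. The last case arises because `b` need not be boolean. -/
theorem evalTerms_select (B c : ℤ) (a b : Aff (Var I J)) (σ : State I J) (ha : 0 ≤ a.eval σ)
    (ha' : a.eval σ ≤ B) (hb : 0 ≤ b.eval σ) :
    evalTerms (selectTerms B c a b) σ = if b.eval σ = 1 then c * a.eval σ else 0 := by
  simp only [evalTerms, selectTerms, List.map_cons, List.map_nil, List.sum_cons, List.sum_nil,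
    Aff.eval_add, Aff.eval_sub, Aff.eval_smul, Aff.eval_constant]
  generalize a.eval σ = u at *
  generalize b.eval σ = v at *
  obtain h | h | h : v = 0 ∨ v = 1 ∨ 2 ≤ v := by omega
  · subst h
    rw [max_eq_left (by linarith), max_eq_left (by norm_num), max_eq_left (by linarith)]
    simp
    ring
  · subst h
    rw [max_eq_left (by linarith), max_eq_right (by norm_num), max_eq_right (by linarith)]
    simp
  · rw [max_eq_right (by nlinarith), max_eq_right (by linarith), max_eq_right (by nlinarith),
      if_neg (by omega)]
    simp

/-- All values of `σ` lie in `{0, ..., B}`. -/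
def State.Within (B : ℕ) (σ : State I J) : Prop := ∀ v, 0 ≤ σ v ∧ σ v ≤ B

theorem Operand.val_within {B : ℕ} {a : Operand I J} (ha : a.ConstsLe B) {σ : State I J}
    (hσ : σ.Within B) : 0 ≤ a.val σ ∧ a.val σ ≤ B := by
  cases a with
  | const c =>
    have : c ≤ B := ha
    simp only [Operand.val]; omega
  | var v => exact hσ v

theorem Instr.exec_eq_update (s : Instr I J) (σ : State I J) :
    s.exec σ = Function.update σ s.target (s.exec σ s.target) := by
  cases s <;> simp [Instr.exec, Instr.target]

/-- Here boundedness of the run matters: rectification would clip a negative result of a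
subtraction, and the selection needs values at most `B`. -/
theorem Instr.evalTerms_eq {B : ℕ} {s : Instr I J} (hs : s.ConstsLe B) {σ : State I J}
    (hσ : σ.Within B) (h : 0 ≤ s.exec σ s.target) :
    evalTerms (s.terms B) σ = s.exec σ s.target := by
  cases s <;>
    simp only [Instr.exec, Instr.target, Instr.terms, Function.update_self, evalTerms_cons,
      evalTerms_append, evalTerms_cmp, evalTerms_nil, Operand.eval_aff, Aff.eval_add,
      Aff.eval_sub, Aff.eval_smul, Aff.eval_coord, Aff.eval_constant] at h ⊢
  case assign x a => rw [max_eq_left h]; ring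
  case cond x b a a' =>
    have ha := Operand.val_within hs.1 hσ
    have ha' := Operand.val_within hs.2 hσ
    rw [evalTerms_select _ _ _ _ _ (by simpa using ha.1) (by simpa using ha.2)
        (by simpa using (hσ b).1),
      evalTerms_select _ _ _ _ _ (by simpa using ha'.1) (by simpa using ha'.2)
        (by simpa using (hσ b).1), max_eq_left ha'.1]
    simp only [Operand.eval_aff, Aff.eval_coord]
    split_ifs <;> ring
  all_goals first | rfl | (rw [max_eq_left h]; ring)

/-- A bound for the gates, the coefficients and the forms. -/
def gateBound (B : ℕ) : ℤ := 2 * B ^ 2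

/-- The terms have small coefficients and small values at bounded states. -/
def GoodTerms (B : ℕ) (l : List (Aff (Var I J) × ℤ)) : Prop :=
  ∀ t ∈ l, t.1.Bounded (gateBound B) ∧ |t.2| ≤ B ∧
    ∀ σ : State I J, σ.Within B → t.1.eval σ ≤ gateBound B

/-- The quadratic bound is needed for products `c * y`; all other forms and their coefficients are
covered by 4 B. -/
theorem four_mul_le_gateBound {B : ℕ} (hB : 2 ≤ B) : 4 * (B : ℤ) ≤ gateBound B := by
  have : (2 : ℤ) ≤ B := by exact_mod_cast hB
  unfold gateBound; nlinarith

theorem GoodTerms.append {B : ℕ} {l l' : List (Aff (Var I J) × ℤ)} (h : GoodTerms B l)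
    (h' : GoodTerms B l') : GoodTerms B (l ++ l') := by
  intro t ht
  rcases List.mem_append.1 ht with ht | ht
  exacts [h t ht, h' t ht]

/-- An affine form that is at most `B` in absolute value at bounded states. -/
def SimpleAff (B : ℕ) (u : Aff (Var I J)) : Prop :=
  u.Bounded B ∧ ∀ σ : State I J, σ.Within B → 0 ≤ u.eval σ ∧ u.eval σ ≤ B

theorem simpleAff_coord {B : ℕ} (hB : 2 ≤ B) (v : Var I J) : SimpleAff B (.coord v) :=
  ⟨(Aff.bounded_coord v).mono (by exact_mod_cast one_le_two.trans hB), fun σ hσ => by simpa using hσ v⟩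

theorem simpleAff_constant {B c : ℕ} (hc : c ≤ B) :
    SimpleAff B (.constant c : Aff (Var I J)) :=
  ⟨(Aff.bounded_constant (c : ℤ)).mono (by rw [Nat.abs_cast]; exact_mod_cast hc),
    fun σ _ => by simpa using hc⟩

theorem Operand.simpleAff {B : ℕ} (hB : 2 ≤ B) {a : Operand I J} (ha : a.ConstsLe B) :
    SimpleAff B a.aff := by
  cases a with
  | const c => exact simpleAff_constant ha
  | var v => exact simpleAff_coord hB v

theorem goodTerms_nil (B : ℕ) : GoodTerms B ([] : List (Aff (Var I J) × ℤ)) := by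
  intro t ht; simp at ht

theorem goodTerms_cons {B : ℕ} {t : Aff (Var I J) × ℤ} {l : List (Aff (Var I J) × ℤ)}
    (h₁ : t.1.Bounded (gateBound B)) (h₂ : |t.2| ≤ B)
    (h₃ : ∀ σ : State I J, σ.Within B → t.1.eval σ ≤ gateBound B) (h : GoodTerms B l) :
    GoodTerms B (t :: l) := by
  intro t' ht
  rcases List.mem_cons.1 ht with rfl | ht
  exacts [⟨h₁, h₂, h₃⟩, h t' ht]

theorem goodTerms_geTerms {B : ℕ} (hB : 2 ≤ B) {u v : Aff (Var I J)}
    (hu : u.Bounded B) (hv : v.Bounded (B + 1))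
    (h : ∀ σ : State I J, σ.Within B → u.eval σ - v.eval σ ≤ B) :
    GoodTerms B (geTerms u v) := by
  have h4 := four_mul_le_gateBound hB
  have hB' : (2 : ℤ) ≤ B := by exact_mod_cast hB
  have h1 : |(1 : ℤ)| ≤ B := by rw [abs_one]; linarith
  refine goodTerms_cons (((hu.sub hv).add (Aff.bounded_constant 1)).mono ?_) h1 ?_
    (goodTerms_cons ((hu.sub hv).mono ?_) (by simpa using h1) ?_ (goodTerms_nil B))
  · rw [abs_one]; linarith
  · intro σ hσ
    have := h σ hσ
    simp only [Aff.eval_add, Aff.eval_sub, Aff.eval_constant]; linarith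
  · linarith
  · intro σ hσ
    have := h σ hσ
    simp only [Aff.eval_sub]; linarith

theorem goodTerms_cmp {B : ℕ} (hB : 2 ≤ B) (r : Cmp) {u v : Aff (Var I J)}
    (hu : SimpleAff B u) (hv : SimpleAff B v) : GoodTerms B (r.terms u v) := by
  have hB' : (2 : ℤ) ≤ B := by exact_mod_cast hB
  have h4 := four_mul_le_gateBound hB
  have key : ∀ {u v : Aff (Var I J)}, SimpleAff B u → SimpleAff B v →
      GoodTerms B (geTerms u v) ∧ GoodTerms B (geTerms u (v + .constant 1)) := by
    intro u v hu hv
    refine ⟨goodTerms_geTerms hB hu.1 (hv.1.mono (by linarith)) fun σ hσ => ?_,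
      goodTerms_geTerms hB hu.1 ((hv.1.add (Aff.bounded_constant 1)).mono (by simp))
        fun σ hσ => ?_⟩
    · linarith [(hu.2 σ hσ).2, (hv.2 σ hσ).1]
    · rw [Aff.eval_add, Aff.eval_constant]
      linarith [(hu.2 σ hσ).2, (hv.2 σ hσ).1]
  cases r
  · refine ((key hu hv).1.append (key hv hu).1).append (goodTerms_cons ?_ ?_ ?_ (goodTerms_nil B))
    · exact (Aff.bounded_constant 1).mono (by rw [abs_one]; linarith)
    · rw [abs_neg, abs_one]; linarith
    · intro σ _
      rw [Aff.eval_constant]; linarith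
  · exact (key hv hu).2
  · exact (key hv hu).1
  · exact (key hu hv).2
  · exact (key hu hv).1

theorem goodTerms_select {B : ℕ} (hB : 2 ≤ B) {c : ℤ} (hc : |c| ≤ 1) {a b : Aff (Var I J)}
    (ha : SimpleAff B a) (hb : SimpleAff B b) (hb' : b.Bounded 1) :
    GoodTerms B (selectTerms B c a b) := by
  have hB' : (2 : ℤ) ≤ B := by exact_mod_cast hB
  have h4 := four_mul_le_gateBound hB
  have hs := ha.1.sub (hb'.smul (c := (B : ℤ)) (by linarith))
  refine goodTerms_cons ((hs.add (Aff.bounded_constant (B : ℤ))).mono ?_) (by simpa using by linarith)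
    ?_ (goodTerms_cons (((Aff.bounded_constant 1).sub hb').mono ?_) ?_ ?_
      (goodTerms_cons (hs.mono ?_) ?_ ?_ (goodTerms_nil B)))
  · rw [Nat.abs_cast]; linarith
  · intro σ hσ
    rw [Aff.eval_add, Aff.eval_sub, Aff.eval_smul, Aff.eval_constant]
    nlinarith [ha.2 σ hσ, hb.2 σ hσ]
  · rw [abs_one]; linarith
  · rw [abs_mul, abs_neg, Nat.abs_cast]; nlinarith
  · intro σ hσ
    rw [Aff.eval_sub, Aff.eval_constant]
    linarith [(hb.2 σ hσ).1]
  · linarith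
  · rw [abs_neg]; linarith
  · intro σ hσ
    rw [Aff.eval_sub, Aff.eval_smul]
    nlinarith [ha.2 σ hσ, hb.2 σ hσ]

theorem Instr.goodTerms {B : ℕ} (hB : 2 ≤ B) {s : Instr I J} (hs : s.ConstsLe B) :
    GoodTerms B (s.terms B) := by
  have hB' : (2 : ℤ) ≤ B := by exact_mod_cast hB
  have h4 := four_mul_le_gateBound hB
  have h1 : |(1 : ℤ)| ≤ B := by rw [abs_one]; linarith
  have hc := simpleAff_coord (I := I) (J := J) hB
  cases s with
  | assign x a =>
    have ha := Operand.simpleAff hB (a := a) hs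
    exact goodTerms_cons (ha.1.mono (by linarith)) h1
      (fun σ hσ => by linarith [(ha.2 σ hσ).2]) (goodTerms_nil B)
  | cond x b a a' =>
    have ha := Operand.simpleAff hB hs.1
    have ha' := Operand.simpleAff hB hs.2
    exact (goodTerms_select hB (by simp) ha (hc b) (Aff.bounded_coord b)).append
      (goodTerms_cons (ha'.1.mono (by linarith)) h1 (fun σ hσ => by linarith [(ha'.2 σ hσ).2])
        (goodTerms_select hB (by simp) ha' (hc b) (Aff.bounded_coord b)))
  | addConst x y c =>
    have hcc : |c| ≤ B := by
      have : c.natAbs ≤ B := hs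
      rw [Int.abs_eq_natAbs]; exact_mod_cast this
    refine goodTerms_cons (((hc y).1.add (Aff.bounded_constant c)).mono (by linarith)) h1
      (fun σ hσ => ?_) (goodTerms_nil B)
    rw [Aff.eval_add, Aff.eval_constant]
    linarith [((hc y).2 σ hσ).2, le_abs_self c]
  | mulConst x c y =>
    have hcc : (c : ℤ) ≤ B := by exact_mod_cast (show c ≤ B from hs)
    have hc0 : (0 : ℤ) ≤ c := by positivity
    refine goodTerms_cons (((Aff.bounded_coord y).smul hc0).mono (by linarith)) h1
      (fun σ hσ => ?_) (goodTerms_nil B)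
    rw [Aff.eval_smul, gateBound]
    nlinarith [(hc y).2 σ hσ, mul_le_mul hcc ((hc y).2 σ hσ).2 ((hc y).2 σ hσ).1 (by linarith)]
  | cmpConst x r y c => exact goodTerms_cmp hB r (hc y) (simpleAff_constant hs)
  | add x y z =>
    refine goodTerms_cons (((hc y).1.add (hc z).1).mono (by linarith)) h1
      (fun σ hσ => ?_) (goodTerms_nil B)
    rw [Aff.eval_add]
    linarith [((hc y).2 σ hσ).2, ((hc z).2 σ hσ).2]
  | sub x y z =>
    refine goodTerms_cons (((hc y).1.sub (hc z).1).mono (by linarith)) h1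
      (fun σ hσ => ?_) (goodTerms_nil B)
    rw [Aff.eval_sub]
    linarith [((hc y).2 σ hσ).2, ((hc z).2 σ hσ).1]
  | cmpVar x r y z => exact goodTerms_cmp hB r (hc y) (hc z)

theorem Instr.length_terms_le (B : ℕ) (s : Instr I J) : (s.terms B).length ≤ 7 := by
  cases s <;> try simp [Instr.terms, selectTerms]
  all_goals
    rename_i r _ _
    cases r <;> simp [Cmp.terms, geTerms]

/-! ## Gated updates -/

/-- The coordinates of a simulation state: the variables, a nonnegative counter (`false`) whose
vanishing activates the instructions, and a number (`true`) that is carried along. -/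
abbrev SimVar (I J : ℕ) : Type := Var I J ⊕ Bool

def pack (σ : State I J) (h z : ℤ) : SimVar I J → ℤ := Sum.elim σ fun b => if b then z else h

/-- The affine form `A - G * h`. -/
def Aff.gate (G : ℤ) (A : Aff (Var I J)) : Aff (SimVar I J) :=
  ⟨Sum.elim A.coef fun b => if b then 0 else -G, A.const⟩

theorem Aff.eval_gate (G : ℤ) (A : Aff (Var I J)) (σ : State I J) (h z : ℤ) :
    (A.gate G).eval (pack σ h z) = A.eval σ - G * h := by
  rw [Aff.eval, Aff.eval, Fintype.sum_sum_type]
  simp [Aff.gate, pack]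
  ring

theorem Aff.Bounded.gate {G : ℤ} (hG : 0 ≤ G) {A : Aff (Var I J)} (h : A.Bounded G) :
    (A.gate G).Bounded G := by
  refine ⟨?_, h.2⟩
  rintro (v | b)
  · exact h.1 v
  · cases b <;> simp [Aff.gate, abs_of_nonneg, hG]

/-- The number of bits of the coefficients used to simulate programs. -/
def simBits (B : ℕ) : ℕ := 2 * Nat.size B + 1

theorem gateBound_le (B : ℕ) : gateBound B ≤ 2 ^ simBits B - 1 := by
  have h : (B : ℤ) + 1 ≤ 2 ^ Nat.size B := by exact_mod_cast Nat.lt_size_self B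
  have hB : (0 : ℤ) ≤ B := by positivity
  rw [simBits, pow_succ, mul_comm 2, pow_mul, gateBound]
  nlinarith

/-- The cost of a gated update. -/
def updateCost (I J B : ℕ) : ℕ := 8 + 2 * (I + J + 11) ^ 2 * (simBits B + 3)

/-- An update of the state by `c`, and, if the counter is zero, by rectified affine forms. -/
theorem realizes_gated {B : ℕ} (hB : 2 ≤ B) (l : List (Aff (Var I J) × (SimVar I J → ℤ)))
    (c : SimVar I J → ℤ) (hl : l.length ≤ 8) (hc : ∀ i, |c i| ≤ 1)
    (hl₁ : ∀ t ∈ l, t.1.Bounded (gateBound B) ∧ (∀ i, |t.2 i| ≤ B) ∧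
      ∀ σ : State I J, σ.Within B → t.1.eval σ ≤ gateBound B) :
    Realizes (fun x y : SimVar I J → ℤ => ∃ (σ : State I J) (h z : ℤ), σ.Within B ∧ 0 ≤ h ∧
        0 ≤ z ∧ x = pack σ h z ∧ (∀ i, 0 ≤ y i) ∧ ∀ i, y i = x i + c i +
          if h = 0 then (l.map fun t => t.2 i * max (t.1.eval σ) 0).sum else 0)
      (updateCost I J B) := by
  have hB' : (2 : ℤ) ≤ B := by exact_mod_cast hB
  have h4 := four_mul_le_gateBound hB
  have hG := gateBound_le B
  refine (Realizes.update (l.map fun t => (t.1.gate (gateBound B), t.2)) c 8 (simBits B)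
    (by simpa) (by simp [simBits]) ?_ (fun i => (hc i).trans (by linarith))).mono ?_ ?_
  · intro t ht
    obtain ⟨t, ht', rfl⟩ := List.mem_map.1 ht
    exact ⟨((hl₁ t ht').1.gate (by linarith)).mono hG,
      fun i => ((hl₁ t ht').2.1 i).trans (by linarith)⟩
  · rintro x y ⟨σ, h, z, hσ, hh, hz, rfl, hy, e⟩
    refine ⟨?_, hy, fun i => ?_⟩
    · rintro (v | b)
      · exact (hσ v).1
      · cases b <;> simpa [pack]
    · rw [e i, List.map_map]
      congr 1
      split_ifs with h0
      · congr 1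
        apply List.map_congr_left
        intro t _
        simp [Aff.eval_gate, h0]
      · symm
        apply List.sum_eq_zero
        intro a ha
        obtain ⟨t, ht, rfl⟩ := List.mem_map.1 ha
        -- For h ≥ 1 the subtracted multiple of h exceeds or equals the form, which is at most
        -- `gateBound B`.
        have := (hl₁ t ht).2.2 σ hσ
        have h1 : 1 ≤ h := by omega
        simp only [Function.comp_apply, Aff.eval_gate]
        rw [max_eq_right (by nlinarith), mul_zero]
  -- 11 = 2 + 8 + 1: the two extra coordinates, at most eight forms, and the bias.
  · simp [updateCost]

end

section

/-! ## Simulation of programs -/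

variable {I J : ℕ}

/-- Terms that act on a single coordinate. -/
def dirTerms (j : SimVar I J) (l : List (Aff (Var I J) × ℤ)) :
    List (Aff (Var I J) × (SimVar I J → ℤ)) := l.map fun t => (t.1, Pi.single j t.2)

theorem sum_dirTerms (j i : SimVar I J) (l : List (Aff (Var I J) × ℤ)) (σ : State I J) :
    ((dirTerms j l).map fun t => t.2 i * max (t.1.eval σ) 0).sum
      = if i = j then evalTerms l σ else 0 := by
  induction l with
  | nil => simp [dirTerms]
  | cons t l ih =>
    simp only [dirTerms, List.map_cons, List.sum_cons, evalTerms_cons] at ih ⊢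
    rw [ih]
    by_cases h : i = j
    · subst h; simp
    · simp [h]

theorem GoodTerms.dirTerms {B : ℕ} {l : List (Aff (Var I J) × ℤ)} (h : GoodTerms B l)
    (j : SimVar I J) : ∀ t ∈ _root_.dirTerms j l, t.1.Bounded (gateBound B) ∧ (∀ i, |t.2 i| ≤ B) ∧
      ∀ σ : State I J, σ.Within B → t.1.eval σ ≤ gateBound B := by
  intro t ht
  obtain ⟨t, ht', rfl⟩ := List.mem_map.1 ht
  obtain ⟨h₁, h₂, h₃⟩ := h t ht'
  refine ⟨h₁, fun i => ?_, h₃⟩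
  by_cases hi : i = j
  · subst hi; simpa using h₂
  · simp [hi]

def negTerms (l : List (Aff (Var I J) × ℤ)) : List (Aff (Var I J) × ℤ) :=
  l.map fun t => (t.1, -t.2)

theorem evalTerms_negTerms (l : List (Aff (Var I J) × ℤ)) (σ : State I J) :
    evalTerms (negTerms l) σ = - evalTerms l σ := by
  induction l with
  | nil => simp [negTerms]
  | cons t l ih =>
    simp only [negTerms, List.map_cons, evalTerms_cons] at ih ⊢
    rw [ih]; ring

theorem GoodTerms.negTerms {B : ℕ} {l : List (Aff (Var I J) × ℤ)} (h : GoodTerms B l) :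
    GoodTerms B (negTerms l) := by
  intro t ht
  obtain ⟨t, ht', rfl⟩ := List.mem_map.1 ht
  obtain ⟨h₁, h₂, h₃⟩ := h t ht'
  exact ⟨h₁, by simpa using h₂, h₃⟩

theorem pack_nonneg {B : ℕ} {σ : State I J} (hσ : σ.Within B) {h z : ℤ} (hh : 0 ≤ h)
    (hz : 0 ≤ z) (i : SimVar I J) : 0 ≤ pack σ h z i := by
  rcases i with v | b
  · exact (hσ v).1
  · cases b <;> simpa [pack]

/-- Assignment is turned into addition: the forms for the new value are added and the old value of
the target is subtracted, at most 7 + 1 terms. A positive counter silences both. -/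
theorem realizes_instr {B : ℕ} (hB : 2 ≤ B) {s : Instr I J} (hs : s.ConstsLe B) :
    Realizes (fun x y : SimVar I J → ℤ => ∃ (σ : State I J) (h z : ℤ), σ.Within B ∧ 0 ≤ h ∧
        0 ≤ z ∧ x = pack σ h z ∧ ((1 ≤ h ∧ y = pack σ h z) ∨
          (h = 0 ∧ (s.exec σ).Within B ∧ y = pack (s.exec σ) 0 z)))
      (updateCost I J B) := by
  have hB' : (2 : ℤ) ≤ B := by exact_mod_cast hB
  have hc := simpleAff_coord hB s.target
  have h4 := four_mul_le_gateBound hB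
  have hg : GoodTerms B (s.terms B ++ [(.coord s.target, -1)]) :=
    (s.goodTerms hB hs).append (goodTerms_cons (hc.1.mono (by linarith))
      (by rw [abs_neg, abs_one]; linarith) (fun σ hσ => by linarith [(hc.2 σ hσ).2])
      (goodTerms_nil B))
  refine (realizes_gated hB (dirTerms (.inl s.target) (s.terms B ++ [(.coord s.target, -1)])) 0
    ?_ (by simp) (hg.dirTerms _)).mono ?_ le_rfl
  · have := s.length_terms_le B
    simp [dirTerms]; omega
  · rintro x y ⟨σ, h, z, hσ, hh, hz, rfl, ⟨h1, rfl⟩ | ⟨rfl, hσ', rfl⟩⟩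
    · refine ⟨σ, h, z, hσ, hh, hz, rfl, pack_nonneg hσ hh hz, fun i => ?_⟩
      rw [if_neg (by omega)]; simp
    · refine ⟨σ, 0, z, hσ, hh, hz, rfl, pack_nonneg hσ' hh hz, fun i => ?_⟩
      rw [if_pos rfl, sum_dirTerms, evalTerms_append, s.evalTerms_eq hs hσ (hσ' _).1,
        evalTerms_cons, Aff.eval_coord, max_eq_left (hσ _).1, evalTerms_nil]
      rcases i with v | b
      · simp only [pack, Sum.elim_inl, Sum.inl.injEq, Pi.zero_apply]
        rw [s.exec_eq_update, Function.update_apply]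
        split_ifs with hv
        · subst hv; rw [Function.update_self]; ring
        · ring
      · simp [pack]

/-- The counter is raised by 1, and lowered again if the loop is active and nonempty. A positive
counter thus counts the enclosing loops being skipped. -/
theorem realizes_loop_entry {B : ℕ} (hB : 2 ≤ B) {a e : Operand I J} (ha : a.ConstsLe B)
    (he : e.ConstsLe B) :
    Realizes (fun x y : SimVar I J → ℤ => ∃ (σ : State I J) (h z : ℤ), σ.Within B ∧ 0 ≤ h ∧
        0 ≤ z ∧ x = pack σ h z ∧
        y = pack σ (if h = 0 ∧ a.val σ ≤ e.val σ then 0 else h + 1) z)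
      (updateCost I J B) := by
  have ha' := Operand.simpleAff hB ha
  have he' := Operand.simpleAff hB he
  have hg : GoodTerms B (negTerms (geTerms e.aff a.aff)) :=
    (goodTerms_geTerms hB he'.1 (ha'.1.mono (by linarith))
      fun σ hσ => by linarith [(he'.2 σ hσ).2, (ha'.2 σ hσ).1]).negTerms
  refine (realizes_gated hB (dirTerms (.inr false) (negTerms (geTerms e.aff a.aff)))
    (Pi.single (.inr false) 1) (by simp [dirTerms, negTerms, geTerms]) ?_
    (hg.dirTerms _)).mono ?_ le_rfl
  · intro i
    rw [Pi.single_apply]; split_ifs <;> simp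
  · rintro x y ⟨σ, h, z, hσ, hh, hz, rfl, rfl⟩
    refine ⟨σ, h, z, hσ, hh, hz, rfl, pack_nonneg hσ (by split_ifs <;> omega) hz, fun i => ?_⟩
    rw [sum_dirTerms, evalTerms_negTerms, evalTerms_geTerms, Operand.eval_aff, Operand.eval_aff]
    rcases i with v | _ | _
    · simp [pack]
    · simp only [pack, Sum.elim_inr, if_true, Pi.single_eq_same]
      split_ifs <;> simp_all
    · simp [pack]

/-- Advancing the counter `x` of a running loop, or leaving the loop. -/
def LoopNext (B : ℕ) (x : Var I J) (e : Operand I J) (s t : SimVar I J → ℤ) : Prop :=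
  ∃ (σ : State I J) (h z : ℤ), σ.Within B ∧ 0 ≤ h ∧ 0 ≤ z ∧ s = pack σ h z ∧
    t = if h = 0 then
      if σ x < e.val σ then pack (Function.update σ x (σ x + 1)) 0 z else pack σ 1 z
      else pack σ h z

/-- If active, `x` grows by the truth value of e ≥ x + 1 and the counter h by that of x ≥ e; exactly
one of the two changes. -/
theorem realizes_loop_next {B : ℕ} (hB : 2 ≤ B) (x : Var I J) {e : Operand I J}
    (he : e.ConstsLe B) : Realizes (LoopNext B x e) (updateCost I J B) := by
  have hx := simpleAff_coord hB x
  have he' := Operand.simpleAff hB he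
  have hg₁ : GoodTerms B (geTerms e.aff (.coord x + .constant 1)) :=
    goodTerms_geTerms hB he'.1 ((hx.1.add (Aff.bounded_constant 1)).mono (by simp)) fun σ hσ => by
      rw [Aff.eval_add, Aff.eval_constant]
      linarith [(he'.2 σ hσ).2, (hx.2 σ hσ).1]
  have hg₂ : GoodTerms B (geTerms (.coord x) e.aff) :=
    goodTerms_geTerms hB hx.1 (he'.1.mono (by linarith))
      fun σ hσ => by linarith [(he'.2 σ hσ).1, (hx.2 σ hσ).2]
  refine (realizes_gated hB (dirTerms (.inl x) (geTerms e.aff (.coord x + .constant 1)) ++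
    dirTerms (.inr false) (geTerms (.coord x) e.aff)) 0 (by simp [dirTerms, geTerms]) (by simp)
    ?_).mono ?_ le_rfl
  · intro t ht
    rcases List.mem_append.1 ht with ht | ht
    exacts [hg₁.dirTerms _ t ht, hg₂.dirTerms _ t ht]
  · rintro s t ⟨σ, h, z, hσ, hh, hz, rfl, rfl⟩
    have hu : σ x < e.val σ → State.Within B (Function.update σ x (σ x + 1)) := by
      intro hlt v
      have := (Operand.val_within he hσ).2
      rw [Function.update_apply]
      split_ifs
      · have := hσ x; omega
      · exact hσ v
    refine ⟨σ, h, z, hσ, hh, hz, rfl, ?_, fun i => ?_⟩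
    · split_ifs with h0 hlt
      exacts [pack_nonneg (hu hlt) le_rfl hz, pack_nonneg hσ zero_le_one hz, pack_nonneg hσ hh hz]
    · rw [List.map_append, List.sum_append, sum_dirTerms, sum_dirTerms, evalTerms_geTerms,
        evalTerms_geTerms, Aff.eval_add, Aff.eval_constant, Aff.eval_coord, Operand.eval_aff]
      split_ifs with h0 hlt <;> rcases i with v | _ | _ <;>
        simp [pack, h0, Function.update_apply] at * <;> grind

/-- The counter is positive here: 1 after an executed loop, h + 1 after a skipped one. Lowering it
restores the value held on entry. -/
theorem realizes_loop_exit {B : ℕ} (hB : 2 ≤ B) :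
    Realizes (fun x y : SimVar I J → ℤ => ∃ (σ : State I J) (h z : ℤ), σ.Within B ∧ 1 ≤ h ∧
        0 ≤ z ∧ x = pack σ h z ∧ y = pack σ (h - 1) z)
      (updateCost I J B) := by
  refine (realizes_gated hB [] (Pi.single (.inr false) (-1)) (by simp) ?_ (by simp)).mono ?_ le_rfl
  · intro i
    rw [Pi.single_apply]; split_ifs <;> simp
  · rintro x y ⟨σ, h, z, hσ, hh, hz, rfl, rfl⟩
    refine ⟨σ, h, z, hσ, by omega, hz, rfl, pack_nonneg hσ (by omega) hz, fun i => ?_⟩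
    rcases i with v | _ | _ <;> simp [pack]
    ring

theorem Block.RunsWithin.start {B : ℕ} : ∀ {b : Block I J} {σ : State I J}, b.RunsWithin B σ →
    σ.Within B
  | .nil, _, h => h
  | .instr _ _, _, h => h.1
  | .loop _ _ _ _ _, _, h => h.1

theorem Block.RunsWithin.final {B : ℕ} : ∀ {b : Block I J} {σ : State I J}, b.RunsWithin B σ →
    (b.exec σ).Within B
  | .nil, _, h => h
  | .instr _ rest, _, h => Block.RunsWithin.final (b := rest) h.2
  | .loop _ _ _ _ rest, _, h => Block.RunsWithin.final (b := rest) h.2.2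

theorem loopState_of_not_modifies {f : State I J → State I J} {v x : Var I J}
    (hf : ∀ σ, f σ v = σ v) (hx : v ≠ x) (a : ℤ) (σ : State I J) (k : ℕ) :
    loopState f x a σ k v = σ v := by
  induction k with
  | zero => rfl
  | succ k ih => rw [loopState, hf, Function.update_of_ne hx, ih]

theorem Block.exec_of_not_modifies {v : Var I J} : ∀ {b : Block I J}, ¬ b.Modifies v →
    ∀ σ, b.exec σ v = σ v
  | .nil, _, _ => rfl
  | .instr s rest, h, σ => by
      have h₁ : v ≠ s.target := fun e => h (Or.inl e.symm)
      rw [Block.exec, Block.exec_of_not_modifies fun h' => h (Or.inr h'), s.exec_eq_update,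
        Function.update_of_ne h₁]
  | .loop x a e body rest, h, σ => by
      rw [Block.exec, Block.exec_of_not_modifies fun h' => h (Or.inr (Or.inr h'))]
      exact loopState_of_not_modifies
        (Block.exec_of_not_modifies fun h' => h (Or.inr (Or.inl h')))
        (fun e => h (Or.inl e.symm)) _ _ _

/-- Simulation of a block: it is executed if the counter is zero, and skipped otherwise. -/
def Block.SimRel (B : ℕ) (b : Block I J) (x y : SimVar I J → ℤ) : Prop :=
  ∃ (σ : State I J) (h z : ℤ), σ.Within B ∧ 0 ≤ h ∧ 0 ≤ z ∧ x = pack σ h z ∧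
    ((1 ≤ h ∧ y = pack σ h z) ∨ (h = 0 ∧ b.RunsWithin B σ ∧ y = pack (b.exec σ) 0 z))

/-- The sequence of states at the ends of the repetitions of a loop, started with `0 < n`
repetitions to be executed. -/
theorem loop_iterations {B : ℕ} {x : Var I J} {a e : Operand I J} {body : Block I J}
    (hx : ¬ body.Modifies x) (he : ∀ v, e = .var v → v ≠ x ∧ ¬ body.Modifies v)
    {σ : State I J} {z : ℤ} (hz : 0 ≤ z) (ha : 0 ≤ a.val σ) (heB : e.val σ ≤ B)
    (hae : a.val σ ≤ e.val σ)
    (hrun : ∀ k < loopCount (a.val σ) (e.val σ), body.RunsWithin B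
      (Function.update (loopState body.exec x (a.val σ) σ k) x (a.val σ + k))) :
    ∃ u : ℕ → SimVar I J → ℤ, u 0 = pack (Function.update σ x (a.val σ)) 0 z ∧
      u (B + 1) = pack (loopState body.exec x (a.val σ) σ (loopCount (a.val σ) (e.val σ))) 1 z ∧
      ∀ i < B + 1, Relation.Comp (body.SimRel B) (LoopNext B x e) (u i) (u (i + 1)) := by
  set n := loopCount (a.val σ) (e.val σ) with hn
  set τ := loopState body.exec x (a.val σ) σ with hτ
  have hn' : (n : ℤ) = e.val σ - a.val σ + 1 := by rw [hn, loopCount]; omega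
  have hτs : ∀ k, body.exec (Function.update (τ k) x (a.val σ + k)) = τ (k + 1) := fun k => rfl
  -- Since the clause changes neither `x` nor `e`, the test made after each repetition compares the
  -- true loop counter with the bound evaluated on entry.
  have hτx : ∀ k, τ (k + 1) x = a.val σ + k := fun k => by
    rw [← hτs, Block.exec_of_not_modifies hx, Function.update_self]
  have hτe : ∀ k, e.val (τ k) = e.val σ := fun k => by
    cases e with
    | const c => rfl
    | var v =>
      obtain ⟨h₁, h₂⟩ := he v rfl
      exact loopState_of_not_modifies (Block.exec_of_not_modifies h₂) h₁ _ _ _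
  have hW : ∀ k < n, (τ (k + 1)).Within B := fun k hk => by
    rw [← hτs]; exact (hrun k hk).final
  -- After the `n` genuine repetitions the state is frozen by counter value 1. The copies suffice
  -- because n = e - a + 1 ≤ B + 1.
  refine ⟨fun i => if i < n then pack (Function.update (τ i) x (a.val σ + i)) 0 z
    else pack (τ n) 1 z, ?_, ?_, fun i _ => ?_⟩
  · dsimp only
    rw [if_pos (by omega)]
    simp [hτ, loopState]
  · dsimp only
    rw [if_neg (by omega)]
  · dsimp only
    by_cases hi : i < n
    · rw [if_pos hi]
      refine ⟨pack (τ (i + 1)) 0 z, ⟨_, 0, z, (hrun i hi).start, le_rfl, hz, rfl,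
        Or.inr ⟨rfl, hrun i hi, by rw [hτs]⟩⟩, ?_⟩
      refine ⟨τ (i + 1), 0, z, hW i hi, le_rfl, hz, rfl, ?_⟩
      rw [if_pos rfl, hτx, hτe]
      by_cases hi' : i + 1 < n
      · rw [if_pos hi', if_pos (by omega)]
        push_cast
        rw [add_assoc]
      · rw [if_neg hi', if_neg (by omega), show i + 1 = n by omega]
    · rw [if_neg hi, if_neg (by omega)]
      obtain ⟨k, hk⟩ : ∃ k, n = k + 1 := ⟨n - 1, by omega⟩
      have hWn : (τ n).Within B := by rw [hk]; exact hW k (by omega)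
      refine ⟨_, ⟨_, 1, z, hWn, zero_le_one, hz, rfl, Or.inl ⟨le_rfl, rfl⟩⟩, ?_⟩
      exact ⟨τ n, 1, z, hWn, zero_le_one, hz, rfl, by rw [if_neg one_ne_zero]⟩

/-- A loop is compiled to an entry test, the assignment x = a, B + 1 copies of clause and advance,
and an exit. Besides its clause it costs four updates and the repetition symbols, which fit into a
fifth. -/
theorem realizes_block {B : ℕ} (hB : 2 ≤ B) : ∀ {b : Block I J}, b.ConstsLe B → b.WellFormed →
    Realizes (b.SimRel B) (5 * updateCost I J B * b.length)
  | .nil, _, _ => by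
      refine Realizes.refl.mono ?_ (Nat.zero_le _)
      rintro x y ⟨σ, h, z, -, -, -, rfl, ⟨-, rfl⟩ | ⟨rfl, -, rfl⟩⟩ <;> rfl
  | .instr s rest, hc, hw => by
      refine ((realizes_instr hB hc.1).comp (realizes_block hB hc.2 hw)).mono ?_ ?_
      · rintro x y ⟨σ, h, z, hσ, hh, hz, rfl, ⟨h1, rfl⟩ | ⟨rfl, hr, rfl⟩⟩
        · exact ⟨_, ⟨σ, h, z, hσ, hh, hz, rfl, Or.inl ⟨h1, rfl⟩⟩,
            σ, h, z, hσ, hh, hz, rfl, Or.inl ⟨h1, rfl⟩⟩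
        · exact ⟨_, ⟨σ, 0, z, hσ, hh, hz, rfl, Or.inr ⟨rfl, hr.2.start, rfl⟩⟩,
            _, 0, z, hr.2.start, hh, hz, rfl, Or.inr ⟨rfl, hr.2, rfl⟩⟩
      · rw [Block.length]; nlinarith
  | .loop x a e body rest, ⟨hca, hce, hcb, hcr⟩, ⟨hwx, hwe, hwb, hwr⟩ => by
      have hcs : (Instr.assign x a : Instr I J).ConstsLe B := hca
      refine ((realizes_loop_entry hB hca hce).comp ((realizes_instr hB hcs).comp
        ((((realizes_block hB hcb hwb).comp (realizes_loop_next hB x hce)).iterate (B + 1)).comp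
        ((realizes_loop_exit hB).comp (realizes_block hB hcr hwr))))).mono ?_ ?_
      · rintro s t ⟨σ, h, z, hσ, hh, hz, rfl, hst⟩
        by_cases hact : h = 0 ∧ a.val σ ≤ e.val σ
        · obtain ⟨rfl, hae⟩ := hact
          obtain ⟨-, hr, rfl⟩ := hst.resolve_left (by omega)
          have ha := Operand.val_within hca hσ
          have he := Operand.val_within hce hσ
          obtain ⟨u, hu₀, hu₁, hu⟩ := loop_iterations hwx hwe hz ha.1 he.2 hae hr.2.1
          have h0 : 0 < loopCount (a.val σ) (e.val σ) := by rw [loopCount]; omega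
          have hw₀ : State.Within B (Function.update σ x (a.val σ)) := by
            simpa [loopState] using (hr.2.1 0 h0).start
          refine ⟨_, ⟨σ, 0, z, hσ, hh, hz, rfl, rfl⟩, _, ⟨σ, 0, z, hσ, hh, hz, ?_,
            Or.inr ⟨rfl, hw₀, rfl⟩⟩, _, ⟨u, hu₀, hu₁, hu⟩, _,
            ⟨_, 1, z, hr.2.2.start, le_rfl, hz, rfl, rfl⟩,
            _, 0, z, hr.2.2.start, le_rfl, hz, by simp, Or.inr ⟨rfl, hr.2.2, rfl⟩⟩
          rw [if_pos ⟨rfl, hae⟩]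
        -- The loop is inactive or its range is empty. The raised counter h + 1 also suppresses x =
        -- a, so an empty loop leaves `x` untouched, as in Python.
        · refine ⟨_, ⟨σ, h, z, hσ, hh, hz, rfl, rfl⟩, _, ⟨σ, h + 1, z, hσ, by omega, hz, ?_,
            Or.inl ⟨by omega, rfl⟩⟩, pack σ (h + 1) z, ⟨fun _ => pack σ (h + 1) z, rfl, rfl,
            fun i _ => ⟨_, ⟨σ, h + 1, z, hσ, by omega, hz, rfl, Or.inl ⟨by omega, rfl⟩⟩,
            σ, h + 1, z, hσ, by omega, hz, rfl, by rw [if_neg (by omega)]⟩⟩, _,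
            ⟨σ, h + 1, z, hσ, by omega, hz, rfl, rfl⟩, σ, h, z, hσ, hh, hz, by simp, ?_⟩
          · rw [if_neg hact]
          · rcases hst with ⟨h1, rfl⟩ | ⟨rfl, hr, rfl⟩
            · exact Or.inl ⟨h1, rfl⟩
            · have h0 : loopCount (a.val σ) (e.val σ) = 0 := by rw [loopCount]; omega
              refine Or.inr ⟨rfl, ?_, ?_⟩
              · simpa [h0, loopState] using hr.2.2
              · simp [Block.exec, h0, loopState]
      · have hlt : B + 1 < 2 ^ simBits B := by
          have := gateBound_le B
          have := four_mul_le_gateBound hB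
          zify; linarith
        have := length_binNat_le hlt
        have h3 : 3 + (binNat (B + 1)).length ≤ updateCost I J B := by
          rw [updateCost]; nlinarith [Nat.zero_le ((I + J) * (simBits B + 3)), Nat.zero_le ((I + J) ^ 2 * (simBits B + 3))]
        rw [Block.length]
        nlinarith

end

section

/-! ## Memorization -/

variable {I J N : ℕ}

/-- A number that identifies the input `x` among all inputs with entries at most `B`. -/
def inputTag (B : ℕ) (x : Input I N) : ℤ := ∑ i, ((x i : ℕ) : ℤ) * (2 ^ Nat.size B) ^ (i : ℕ)

theorem inputTag_eq {B : ℕ} {x : Input I N} (hx : ∀ i, (x i : ℕ) ≤ B) :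
    inputTag B x = (finFunctionFinEquiv (fun i => (⟨x i, (hx i).trans_lt (Nat.lt_size_self B)⟩ :
      Fin (2 ^ Nat.size B))) : ℕ) := by
  rw [finFunctionFinEquiv_apply]
  simp [inputTag]

/-- The coordinates are the digits of the tag in base 2 ^ `Nat.size B`, which exceeds B. -/
theorem inputTag_injective {B : ℕ} (hB : ∀ (x : Input I N) i, (x i : ℕ) ≤ B) :
    Function.Injective (inputTag B : Input I N → ℤ) := by
  intro x y h
  rw [inputTag_eq (hB x), inputTag_eq (hB y), Nat.cast_inj, Fin.val_inj,
    EmbeddingLike.apply_eq_iff_eq] at h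
  funext i
  exact Subtype.ext (by simpa using congrFun h i)

theorem inputTag_nonneg (B : ℕ) (x : Input I N) : 0 ≤ inputTag B x :=
  Finset.sum_nonneg fun i _ => by positivity

theorem inputTag_lt {B : ℕ} (hB : ∀ (x : Input I N) i, (x i : ℕ) ≤ B) (x : Input I N) :
    inputTag B x < 2 ^ (I * Nat.size B) := by
  rw [inputTag_eq (hB x)]
  have := (finFunctionFinEquiv (fun i => (⟨x i, (hB x i).trans_lt (Nat.lt_size_self B)⟩ :
      Fin (2 ^ Nat.size B)))).2
  rw [mul_comm, pow_mul]
  exact_mod_cast this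

/-- A state consisting of an output value and a tag. -/
def outputPair (y z : ℤ) : Bool → ℤ := fun b => if b then z else y

/-- The cost of memorizing one value. -/
def memoCost (I B : ℕ) : ℕ := 8 + 72 * (I * Nat.size B + 5)

/-- For integer d, max(d + 1, 0) - 2 max(d, 0) + max(d - 1, 0) is 1 at d = 0 and 0 elsewhere. With d
the difference of two tags, `δ` times this corrects the output at `p` alone. -/
theorem realizes_memo_one {B : ℕ} (hI : 1 ≤ I) (hB : ∀ (x : Input I N) i, (x i : ℕ) ≤ B)
    (p : Input I N) (δ : ℤ) (hδ : |δ| ≤ B) :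
    Realizes (fun s t : Bool → ℤ => ∃ (x : Input I N) (y : ℤ), 0 ≤ y ∧ (x = p → 0 ≤ y + δ) ∧
      s = outputPair y (inputTag B x) ∧
      t = outputPair (if x = p then y + δ else y) (inputTag B x)) (memoCost I B) := by
  -- Two spare bits absorb the shifts by one and the doubled weight of the middle form.
  set β := I * Nat.size B + 2 with hβ
  have hQ : (2 : ℤ) ^ β = 4 * 2 ^ (I * Nat.size B) := by rw [hβ, pow_add]; ring
  have hp₀ := inputTag_nonneg B p
  have hp₁ := inputTag_lt hB p
  have hBQ : (B : ℤ) < 2 ^ (I * Nat.size B) := by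
    calc (B : ℤ) < 2 ^ Nat.size B := by exact_mod_cast Nat.lt_size_self B
      _ ≤ 2 ^ (I * Nat.size B) :=
        pow_le_pow_right₀ (by norm_num) (Nat.le_mul_of_pos_left _ hI)
  have hform : ∀ c : ℤ, |c| ≤ 1 →
      (Aff.coord true + Aff.constant (c - inputTag B p) : Aff Bool).Bounded (2 ^ β - 1) := by
    intro c hc
    refine ((Aff.bounded_coord _).add (Aff.bounded_constant _)).mono ?_
    have : |c - inputTag B p| ≤ |c| + |inputTag B p| := abs_sub _ _
    rw [abs_of_nonneg hp₀] at this
    linarith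
  have hdir : ∀ c : ℤ, |c| ≤ 2 → ∀ i, |(Pi.single false (c * δ) : Bool → ℤ) i| ≤ 2 ^ β - 1 := by
    intro c hc i
    cases i
    · rw [Pi.single_eq_same, abs_mul]
      nlinarith [abs_nonneg δ, abs_nonneg c]
    · simp; linarith
  refine (Realizes.update [(Aff.coord true + Aff.constant (1 - inputTag B p), Pi.single false (1 * δ)),
    (Aff.coord true + Aff.constant (0 - inputTag B p), Pi.single false (-2 * δ)),
    (Aff.coord true + Aff.constant (-1 - inputTag B p), Pi.single false (1 * δ))] 0 3 β
    (by simp) (by omega) ?_ ?_).mono ?_ ?_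
  · intro t ht
    simp only [List.mem_cons, List.not_mem_nil, or_false] at ht
    rcases ht with rfl | rfl | rfl
    exacts [⟨hform 1 (by simp), hdir 1 (by simp)⟩, ⟨hform 0 (by simp), hdir (-2) (by simp)⟩,
      ⟨hform (-1) (by simp), hdir 1 (by simp)⟩]
  · intro i
    rw [Pi.zero_apply, abs_zero]; linarith
  · rintro s t ⟨x, y, hy, hyδ, rfl, rfl⟩
    have hx := inputTag_nonneg B x
    refine ⟨?_, ?_, ?_⟩
    · rintro (_ | _) <;> simpa [outputPair]
    · rintro (_ | _)
      · simp only [outputPair]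
        split_ifs <;> simp_all
      · simpa [outputPair]
    · rintro (_ | _)
      · simp only [List.map_cons, List.map_nil, List.sum_cons, List.sum_nil, Pi.single_eq_same,
          Aff.eval_add, Aff.eval_coord, Aff.eval_constant, Pi.zero_apply]
        by_cases h : x = p
        · subst h
          simp [outputPair]
        · have hne : inputTag B x ≠ inputTag B p := fun e => h (inputTag_injective hB e)
          simp only [outputPair, h, if_false, if_true]
          generalize inputTag B x = u at *
          generalize inputTag B p = v at *
          rcases lt_or_gt_of_ne hne with h | h
          · rw [max_eq_right (by linarith), max_eq_right (by linarith),
              max_eq_right (by linarith)]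
            simp
          · rw [max_eq_left (by linarith), max_eq_left (by linarith),
              max_eq_left (by omega)]
            simp
            ring
      · simp [outputPair]
  · simp [memoCost, hβ]

/-- The tag is carried through, so the corrections can be chained. Each point is corrected once,
hence still has the value `g p` at its turn. -/
theorem realizes_memo {B : ℕ} {S : Finset (Input I N)} (hI : S.Nonempty → 1 ≤ I)
    (hB : ∀ (x : Input I N) i, (x i : ℕ) ≤ B) {g t : Input I N → ℤ}
    (hg : ∀ x, 0 ≤ g x ∧ g x ≤ B) (ht : ∀ x ∈ S, 0 ≤ t x ∧ t x ≤ B) :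
    Realizes (fun u v : Bool → ℤ => ∃ x : Input I N, u = outputPair (g x) (inputTag B x) ∧
      v = outputPair (if x ∈ S then t x else g x) (inputTag B x)) (S.card * memoCost I B) := by
  induction S using Finset.induction_on with
  | empty =>
    refine Realizes.refl.mono ?_ (Nat.zero_le _)
    rintro u v ⟨x, rfl, rfl⟩
    simp
  | insert p S hp ih =>
    have htp := ht p (by simp)
    refine ((ih (fun _ => hI (by simp)) fun x hx => ht x (by simp [hx])).comp
      (realizes_memo_one (hI (by simp)) hB p (t p - g p) ?_)).mono ?_ ?_
    · rw [abs_le]; constructor <;> linarith [htp.1, htp.2, (hg p).1, (hg p).2]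
    · rintro u v ⟨x, rfl, rfl⟩
      refine ⟨_, ⟨x, rfl, rfl⟩, x, _, ?_, ?_, rfl, ?_⟩
      · split_ifs with h
        exacts [(ht x (by simp [h])).1, (hg x).1]
      · rintro rfl
        rw [if_neg hp]; linarith [htp.1]
      · congr 1
        by_cases h : x = p
        · subst h; simp [hp]
        · simp [h]
    · rw [Finset.card_insert_of_notMem hp]; linarith

/-! ## Networks computing programs -/

theorem Expands.tail_of_comma {s t : List Symb} (h : Expands (.comma :: s) (.comma :: t)) :
    Expands s t := by
  rcases h.inv with h | ⟨a, s', t', -, hs, h, h'⟩ | ⟨u, v, s', t', k, -, -, -, h, -⟩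
  · simp at h
  · simp only [List.cons.injEq] at h h'
    rwa [h.2, h'.2]
  · simp at h

/-- The layer preparing the initial state of a program. -/
def SNP.startAff (P : SNP I J) (B : ℕ) : SimVar I J → Aff (Fin I)
  | .inl (.inl i) => .coord i
  | .inl (.inr j) => .constant (P.init j)
  | .inr false => .constant 0
  | .inr true => ⟨fun i => (2 ^ Nat.size B) ^ (i : ℕ), 0⟩

theorem SNP.eval_startAff (P : SNP I J) (B : ℕ) (x : Input I N) (k : SimVar I J) :
    (P.startAff B k).eval (fun i => ((x i : ℕ) : ℤ)) = pack (P.start x) 0 (inputTag B x) k := by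
  rcases k with (i | j) | _ | _ <;> simp [SNP.startAff, pack, SNP.start]
  simp [Aff.eval, inputTag, mul_comm]

/-- Only the tag's row has entries of about I log B bits. Counting it separately keeps the first
layer within O(V² log B) symbols. -/
theorem SNP.startAff_bounded (P : SNP I J) {B : ℕ} (hB : 2 ≤ B) (hP : ∀ j, P.init j ≤ B)
    (k : SimVar I J) : (P.startAff B k).Bounded
      (2 ^ (if k = .inr true then I * Nat.size B + 1 else Nat.size B) - 1) := by
  have hBs : (B : ℤ) + 1 ≤ 2 ^ Nat.size B := by exact_mod_cast Nat.lt_size_self B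
  have hB' : (2 : ℤ) ≤ B := by exact_mod_cast hB
  rcases k with (i | j) | _ | _
  · rw [if_neg (by simp)]
    exact (Aff.bounded_coord i).mono (by linarith)
  · rw [if_neg (by simp)]
    refine (Aff.bounded_constant _).mono ?_
    have : (P.init j : ℤ) ≤ B := by exact_mod_cast hP j
    rw [Nat.abs_cast]; linarith
  · rw [if_neg (by simp)]
    exact (Aff.bounded_constant 0).mono (by rw [abs_zero]; linarith)
  · rw [if_pos rfl]
    have h1 : (1 : ℤ) ≤ 2 ^ (I * Nat.size B) := one_le_pow₀ (by norm_num)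
    refine ⟨fun i => ?_, ?_⟩
    · simp only [SNP.startAff]
      rw [abs_of_nonneg (by positivity), ← pow_mul, pow_succ]
      have : (2 : ℤ) ^ (Nat.size B * (i : ℕ)) ≤ 2 ^ (I * Nat.size B) :=
        pow_le_pow_right₀ (by norm_num) (by rw [mul_comm]; gcongr; exact i.2.le)
      linarith
    · simp only [SNP.startAff, abs_zero, pow_succ]
      linarith

theorem inputVec_replicate (x : Input I N) (F : Network I)
    (hF : F.spec = List.replicate I none) (e : Fin I ≃ Fin F.spec.length)
    (he : ∀ i, (e i : ℕ) = i) : F.inputVec x = encode e fun i => ((x i : ℕ) : ℤ) := by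
  funext p
  obtain ⟨i, rfl⟩ := e.surjective p
  have h₁ : F.spec.get (e i) = none := by
    rw [List.get_eq_getElem, List.getElem_of_eq hF]; simp
  have h₂ : (F.spec.take (e i)).count none = i := by
    rw [he, hF, List.take_replicate, List.count_replicate_self]
    exact min_eq_left i.2.le
  unfold Network.inputVec
  simp only [h₁, h₂, i.2, dif_pos]
  simp [encode]

theorem network_cost_le {I V n k L : ℕ} (hI : I ≤ V) (hV : 1 ≤ V) (hn : 2 ≤ n)
    (hk : 0 < k → 1 ≤ I) :
    I * 2 + (4 + (V * ((I + 1) * (n + 3)) + ((I + 1) * (I * n + 1 + 3) + (I + 1) * (n + 3)))) +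
      (5 * (8 + 2 * (V + 11) ^ 2 * (2 * n + 1 + 3)) * L + (4 + 8 * (V + 3)) +
        k * (8 + 72 * (I * n + 5))) + 16 ≤ 5800 * ((L + 1) * V ^ 2 + I * k) * n := by
  have hVn : 2 * V ≤ V * n := by rw [mul_comm]; exact Nat.mul_le_mul_left _ hn
  have hW : V * n ≤ V ^ 2 * n := Nat.mul_le_mul_right _ (by nlinarith)
  have h₀ : (I + 1) * (n + 3) ≤ 6 * (V * n) :=
    (Nat.mul_le_mul (show I + 1 ≤ 2 * V by omega) (show n + 3 ≤ 3 * n by omega)).trans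
      (by nlinarith)
  have h₁ : V * ((I + 1) * (n + 3)) ≤ 6 * (V ^ 2 * n) :=
    (Nat.mul_le_mul_left V h₀).trans (by nlinarith)
  have h₂ : (I + 1) * (I * n + 1 + 3) ≤ 6 * (V ^ 2 * n) := by
    have : I * n ≤ V * n := Nat.mul_le_mul_right _ hI
    exact (Nat.mul_le_mul (show I + 1 ≤ 2 * V by omega)
      (show I * n + 1 + 3 ≤ 3 * (V * n) by omega)).trans (by nlinarith)
  have h₃ : 5 * (8 + 2 * (V + 11) ^ 2 * (2 * n + 1 + 3)) * L ≤ 5800 * (V ^ 2 * n) * L := by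
    refine Nat.mul_le_mul_right _ ?_
    have h : (V + 11) ^ 2 * (2 * n + 1 + 3) ≤ (12 * V) ^ 2 * (4 * n) :=
      Nat.mul_le_mul (Nat.pow_le_pow_left (by omega) 2) (by omega)
    nlinarith
  -- The constant part of a correction is absorbed into I n, which requires I ≥ 1 as soon as there
  -- is a correction.
  have h₄ : k * (8 + 72 * (I * n + 5)) ≤ 5800 * (I * k * n) := by
    rcases Nat.eq_zero_or_pos k with rfl | hk'
    · simp
    · have : n ≤ I * n := Nat.le_mul_of_pos_left _ (hk hk')
      calc k * (8 + 72 * (I * n + 5)) ≤ k * (5800 * (I * n)) := Nat.mul_le_mul_left _ (by omega)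
        _ = _ := by ring
  calc _ ≤ 5800 * (V ^ 2 * n) + 5800 * (V ^ 2 * n) * L + 5800 * (I * k * n) := by omega
    _ = _ := by ring

/-- A bounded program, with its values changed at finitely many inputs, is computed by a network
of small description length. -/
theorem exists_network {B : ℕ} (hB : 2 ≤ B) (hN : 1 ≤ N) {P : SNP I J} (hP : P.BoundedOn N B)
    {S : Finset (Input I N)} (hI : S.Nonempty → 1 ≤ I) {t : Input I N → ℤ}
    (ht : ∀ x ∈ S, 0 ≤ t x ∧ t x ≤ B) :
    ∃ F : Network I, (∀ x : Input I N, F.eval x = ((if x ∈ S then t x else P.output x : ℤ) : ℝ)) ∧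
      F.descLength ≤ 5800 * (P.length * (I + J) ^ 2 + I * S.card) * Nat.size B := by
  have hstart : ∀ x : Input I N, (P.start x).Within B := fun x => (hP.2 x).start
  have hx : ∀ (x : Input I N) i, (x i : ℕ) ≤ B := fun x i => by
    simpa [SNP.start] using (hstart x (.inl i)).2
  have hinit : ∀ j, P.init j ≤ B := fun j => by
    simpa [SNP.start] using (hstart (fun _ => ⟨1, by simp [hN]⟩) (.inr j)).2
  -- Between simulation and memorization all coordinates but the returned value and the tag are
  -- dropped, so the cost of a correction does not depend on V.
  have hcollapse : Realizes (fun (s : SimVar I J → ℤ) (u : Bool → ℤ) => ∃ (σ : State I J) (z : ℤ),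
      0 ≤ σ P.ret ∧ 0 ≤ z ∧ s = pack σ 0 z ∧ u = outputPair (σ P.ret) z)
      (4 + 8 * (I + J + 3)) := by
    refine (Realizes.layer (fun b : Bool => Aff.coord (if b then .inr true else .inl P.ret))
      (fun _ => 1) fun b => (Aff.bounded_coord _).mono (by norm_num)).mono ?_ ?_
    · rintro s u ⟨σ, z, hσ, hz, rfl, rfl⟩
      funext b
      cases b <;> simp [outputPair, pack, hσ, hz]
    · simp; omega
  obtain ⟨f, ts, s, hf, hs, hs', hlen, heval⟩ :=
    ((realizes_block hB hP.1 P.wellFormed).comp hcollapse).comp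
      (realizes_memo hI hx (g := P.output) (fun x => (hP.2 x).final P.ret) ht)
  let spec : List (Option ℤ) := List.replicate I none
  let e : Fin I ≃ Fin spec.length := finCongr (by simp [spec])
  let l₀ : Layer spec.length (Fintype.card (SimVar I J)) :=
    .ofAff e (Fintype.equivFin _) (P.startAff B)
  let l₁ : Layer (Fintype.card Bool) 1 :=
    .ofAff (Fintype.equivFin _) finOneEquiv.symm fun _ : Unit => .coord false
  let F : Network I := ⟨spec, by simp [spec], .hidden l₀ (f (.out l₁))⟩
  have hl₀ : (joinTokens l₀.tokens).length ≤ _ :=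
    Layer.length_ofAff_le e _ _ _ (P.startAff_bounded hB hinit)
  have hl₁ : (joinTokens l₁.tokens).length ≤ 16 :=
    (Layer.length_ofAff_le _ _ _ (fun _ => 1) fun _ => (Aff.bounded_coord _).mono
      (by norm_num)).trans (by simp)
  refine ⟨F, fun x => ?_, ?_⟩
  · rw [Network.eval, inputVec_replicate x F rfl e fun i => rfl]
    change Layers.eval (.hidden l₀ (f (.out l₁))) (encode e _) = _
    rw [Layers.eval_hidden_ofAff]
    have hst : (fun k => max ((P.startAff B k).eval fun i => ((x i : ℕ) : ℤ)) 0)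
        = pack (P.start x) 0 (inputTag B x) := by
      funext k
      rw [P.eval_startAff, max_eq_left (pack_nonneg (hstart x) le_rfl (inputTag_nonneg B x) k)]
    rw [hst, heval _ (outputPair (if x ∈ S then t x else P.output x) (inputTag B x))
      ⟨_, ⟨_, ⟨P.start x, 0, inputTag B x, hstart x, le_rfl, inputTag_nonneg B x, rfl,
        Or.inr ⟨rfl, hP.2 x, rfl⟩⟩, _, inputTag B x, ((hP.2 x).final P.ret).1,
        inputTag_nonneg B x, rfl, rfl⟩, x, rfl, rfl⟩, Layers.eval, Layer.eval_ofAff]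
    simp [encode, outputPair]
  · have htok : F.tokens = (List.replicate I [.inp] ++ l₀.tokens) ++ (ts ++ l₁.tokens) := by
      simp [Network.tokens, F, spec, Layers.tokens]
      exact hf _
    have hE : Expands (joinTokens (List.replicate I [.inp] ++ l₀.tokens) ++
        (s ++ joinTokens l₁.tokens)) (.comma :: F.encoding) := by
      rw [F.comma_cons_encoding, htok, joinTokens_append _ (ts ++ _), joinTokens_append ts]
      refine (expands_joinTokens ?_).append
        (hs.append (expands_joinTokens l₁.isPlain) (not_isDigit_joinTokens_head _)) ?_
      · intro u hu
        rcases List.mem_append.1 hu with hu | hu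
        · obtain rfl := List.eq_of_mem_replicate hu
          simp [Symb.IsPlain]
        · exact l₀.isPlain u hu
      · cases s with
        | nil => simpa using not_isDigit_joinTokens_head _
        | cons a s => simpa using hs'
    obtain ⟨w, hw⟩ : ∃ w, joinTokens (List.replicate I [.inp] ++ l₀.tokens) = .comma :: w := by
      cases h : List.replicate I [Symb.inp] ++ l₀.tokens with
      | nil => simp [Layer.tokens] at h
      | cons u us => exact ⟨_, joinTokens_cons u us⟩
    have hlw := congrArg List.length hw
    rw [joinTokens_append, List.length_append, length_joinTokens (List.replicate _ _)] at hlw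
    simp only [List.map_replicate, List.sum_replicate, List.length_cons,
      smul_eq_mul] at hlw
    rw [hw, List.cons_append] at hE
    refine (F.descLength_le hE.tail_of_comma).trans ?_
    simp only [List.length_append]
    simp only [Fintype.sum_sum_type, Fintype.card_fin, Fintype.sum_bool, Finset.sum_const,
      Finset.card_univ, smul_eq_mul, reduceCtorEq, if_false, if_true, Sum.inr.injEq,
      Bool.false_eq_true] at hl₀
    rw [SNP.length]
    have hn : 2 ≤ Nat.size B := Nat.lt_size.2 (by simpa using hB)
    have hV : 1 ≤ I + J := by
      rcases P.ret with i | j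
      · have := i.2; omega
      · have := j.2; omega
    have hcard : 0 < S.card → 1 ≤ I := fun h => hI (Finset.card_pos.1 h)
    rw [updateCost, simBits, memoCost] at hlen
    generalize Nat.size B = n at *
    generalize S.card = k at *
    generalize P.body.length = L at *
    have hc := network_cost_le (L := L) (Nat.le_add_right I J) hV hn hcard
    generalize (joinTokens l₀.tokens).length = m at hl₀ hlw
    rw [Fintype.card_sum, Fintype.card_fin, Fintype.card_fin] at hl₀
    simp only [List.length_nil] at hlw
    omega

end

/-! ## The lower tail of the number of errors -/

/-- Use exp t ≥ 1 + t + t²/2 and (1 + t + t²/2)(1 - t + t²/2) = 1 + t⁴/4 ≥ 1. -/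
theorem exp_neg_le_quadratic {t : ℝ} (ht : 0 ≤ t) : Real.exp (-t) ≤ 1 - t + t ^ 2 / 2 := by
  have h := Real.quadratic_le_exp_of_nonneg ht
  rw [Real.exp_neg, inv_le_comm₀ (Real.exp_pos t) (by nlinarith [sq_nonneg (t - 1)])]
  refine le_trans ?_ h
  rw [inv_le_iff_one_le_mul₀ (by nlinarith [sq_nonneg (t - 1)])]
  nlinarith [sq_nonneg (t ^ 2)]

section
variable {Ω : Type*} [MeasurableSpace Ω] {μ : Measure Ω} [IsProbabilityMeasure μ]
  {E : Type*} [MeasurableSpace E] {ν : Measure E} [IsProbabilityMeasure ν]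

theorem integral_exp_indicator {A : Set E} (hA : MeasurableSet A) (t : ℝ) :
    ∫ x, Real.exp (t * A.indicator 1 x) ∂ν = 1 - ν.real A * (1 - Real.exp t) := by
  have : (fun x => Real.exp (t * A.indicator 1 x))
      = fun x => 1 - A.indicator (fun _ => 1 - Real.exp t) x := by
    funext x
    by_cases h : x ∈ A <;> simp [h]
  rw [this, integral_sub (integrable_const _) ((integrable_const _).indicator hA),
    integral_indicator_const _ hA]
  simp

/-- A multiplicative Chernoff bound for the lower tail of the number of indices `i` with
`X i ∈ A`. -/
theorem measure_count_le {n : ℕ} {X : Fin n → Ω → E} (hX : ∀ i, Measurable (X i))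
    (hind : iIndepFun X μ) (hlaw : ∀ i, μ.map (X i) = ν) {A : Set E} (hA : MeasurableSet A)
    {ρ ε : ℝ} (hρ : 0 ≤ ρ) (hε : 0 < ε) (hν : ρ + ε ≤ ν.real A) :
    μ.real {ω | ({i | X i ω ∈ A}.ncard : ℝ) ≤ ρ * n}
      ≤ Real.exp (-(n * ε ^ 2 / (2 * ρ + 2 * ε))) := by
  classical
  have hq : 0 < ρ + ε := by linarith
  -- This minimizes the resulting exponent n ((ρ + ε) t²/2 - ε t).
  set t := ε / (ρ + ε) with ht
  have ht0 : 0 ≤ t := by positivity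
  let Z : Fin n → Ω → ℝ := fun i ω => A.indicator 1 (X i ω)
  have hf : Measurable (A.indicator (1 : E → ℝ)) := measurable_one.indicator hA
  have hZ : ∀ i, Measurable (Z i) := fun i => hf.comp (hX i)
  have hZind : iIndepFun Z μ := hind.comp (fun _ => A.indicator 1) fun _ => hf
  have hmgf : ∀ i, mgf (Z i) μ (-t) = 1 - ν.real A * (1 - Real.exp (-t)) := fun i => by
    rw [← integral_exp_indicator hA, ← hlaw i, integral_map (hX i).aemeasurable
      (by fun_prop), mgf]
  have hset : {ω | ({i | X i ω ∈ A}.ncard : ℝ) ≤ ρ * n} = {ω | (∑ i, Z i) ω ≤ ρ * n} := by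
    ext ω
    simp only [Set.mem_ofPred_eq, Finset.sum_apply]
    have : ∑ i, Z i ω = ({i | X i ω ∈ A}.ncard : ℝ) := by
      rw [Set.ncard_eq_toFinset_card', Set.toFinset_ofPred, Finset.card_filter]
      push_cast
      exact Finset.sum_congr rfl fun i _ => by simp [Z, Set.indicator_apply]
    rw [this]
  have hint : Integrable (fun ω => Real.exp (-t * (∑ i, Z i) ω)) μ := by
    refine Integrable.of_bound (C := 1) (by fun_prop) (ae_of_all _ fun ω => ?_)
    rw [Real.norm_eq_abs, Real.abs_exp, Real.exp_le_one_iff, Finset.sum_apply]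
    have : 0 ≤ ∑ i, Z i ω :=
      Finset.sum_nonneg fun i _ => Set.indicator_nonneg (fun _ _ => zero_le_one) _
    nlinarith
  rw [hset]
  refine (measure_le_le_exp_mul_mgf (ρ * n) (by linarith) hint).trans ?_
  rw [hZind.mgf_sum hZ, Finset.prod_congr rfl fun i _ => hmgf i, Finset.prod_const,
    Finset.card_univ, Fintype.card_fin]
  have h1 : 1 - ν.real A * (1 - Real.exp (-t)) ≤ Real.exp (-((ρ + ε) * (t - t ^ 2 / 2))) := by
    have h := exp_neg_le_quadratic ht0
    have ht1 : t ≤ 1 := by rw [ht, div_le_one hq]; linarith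
    have : (ρ + ε) * (t - t ^ 2 / 2) ≤ ν.real A * (1 - Real.exp (-t)) :=
      mul_le_mul hν (by linarith) (by nlinarith) (by linarith)
    have := Real.add_one_le_exp (-((ρ + ε) * (t - t ^ 2 / 2)))
    linarith
  have h0 : 0 ≤ 1 - ν.real A * (1 - Real.exp (-t)) := by
    have h2 : Real.exp (-t) ≤ 1 := Real.exp_le_one_iff.2 (by linarith)
    have h3 := Real.exp_pos (-t)
    have h4 : ν.real A ≤ 1 := measureReal_le_one
    have h5 : 0 ≤ ν.real A := measureReal_nonneg
    nlinarith
  calc _ ≤ Real.exp (- -t * (ρ * n)) * Real.exp (-((ρ + ε) * (t - t ^ 2 / 2))) ^ n := by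
        gcongr
    _ = _ := by
        rw [← Real.exp_nat_mul, ← Real.exp_add]
        congr 1
        have : (2 * ρ + 2 * ε) = 2 * (ρ + ε) := by ring
        rw [this, ht]
        field_simp
        ring

end

/-! ## Minimum-description-length interpolation of corrupted data -/

section
variable {I J N : ℕ}

theorem isProbabilityMeasure_unifInput (hN : 1 ≤ N) : IsProbabilityMeasure (unifInput I N) := by
  have : Nonempty (Set.Icc 1 N) := ⟨⟨1, by simp [hN]⟩⟩
  unfold unifInput
  infer_instance

/-- Without input variables, a corruption rate below `1` means that no label is corrupted. -/
theorem eq_output_of_isEmpty {P : SNP I J} (hI : I = 0) {n : ℕ} {ρ : ℝ} (hρ : ρ < 1)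
    {x : Fin n → Input I N} {y : Fin n → ℕ} {F : Network I} (hF : F.Interpolates x y)
    (hy : ({i | (y i : ℤ) ≠ P.output (x i)}.ncard : ℝ) ≤ ρ * n) (i : Fin n) :
    (y i : ℤ) = P.output (x i) := by
  subst hI
  by_contra hi
  -- There is only one input, and the interpolator forces all its labels to agree; one corrupted
  -- label would mean n of them.
  have hall : {i | (y i : ℤ) ≠ P.output (x i)} = Set.univ := by
    refine Set.eq_univ_of_forall fun j => ?_
    have hx : x j = x i := Subsingleton.elim _ _
    have : y j = y i := by
      have h₁ := hF j
      rw [hx, hF i] at h₁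
      exact_mod_cast h₁.symm
    simpa [this, hx] using hi
  rw [hall, Set.ncard_univ, Nat.card_eq_fintype_card, Fintype.card_fin] at hy
  have : (0 : ℝ) < n := by exact_mod_cast i.pos
  nlinarith

/-- The program network corrected at the corrupted sample points interpolates the data, so
minimality compares `F` with it. -/
theorem descLength_le_of_isMDL {B n : ℕ} (hB : 2 ≤ B) (hN : 1 ≤ N) {P : SNP I J}
    (hP : P.BoundedOn N B) {ρ : ℝ} (hρ : 1 ≤ I ∨ ρ < 1) {x : Fin n → Input I N} {y : Fin n → ℕ}
    {F : Network I} (hF : F.IsMDL x y)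
    (hy : ({i | (y i : ℤ) ≠ P.output (x i)}.ncard : ℝ) ≤ ρ * n) (hyB : ∀ i, y i ≤ B) :
    (F.descLength : ℝ) ≤ 5800 * (P.length * ((I + J : ℕ) : ℝ) ^ 2 + I * ρ * n) * Nat.size B := by
  classical
  let S : Finset (Input I N) :=
    (Finset.univ.filter fun i => (y i : ℤ) ≠ P.output (x i)).image x
  -- Reading the labels off the interpolator `F` makes them a function of the point, even if sample
  -- points coincide.
  let t : Input I N → ℤ := fun p => ⌊F.eval p⌋
  have ht : ∀ i, t (x i) = y i := fun i => by simp [t, hF.1 i]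
  have hI : S.Nonempty → 1 ≤ I := by
    rintro ⟨p, hp⟩
    obtain ⟨i, hi, -⟩ := Finset.mem_image.1 hp
    rcases hρ with h | h
    · exact h
    · by_contra hI
      exact (Finset.mem_filter.1 hi).2 (eq_output_of_isEmpty (by omega) h hF.1 hy i)
  obtain ⟨G, hG, hGd⟩ := exists_network hB hN hP hI (t := t) fun p hp => by
    obtain ⟨i, -, rfl⟩ := Finset.mem_image.1 hp
    rw [ht]
    have := hyB i
    omega
  have hGi : G.Interpolates x y := fun i => by
    rw [hG]
    split_ifs with h
    · rw [ht]; simp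
    · have : (y i : ℤ) = P.output (x i) := by
        by_contra hi
        exact h (Finset.mem_image_of_mem x (by simpa using hi))
      rw [← this]; simp
  have hS : (S.card : ℝ) ≤ ρ * n := by
    refine le_trans ?_ hy
    rw [Set.ncard_eq_toFinset_card', Set.toFinset_ofPred]
    exact_mod_cast Finset.card_image_le
  have h : (F.descLength : ℝ) ≤ 5800 * (P.length * (I + J : ℕ) ^ 2 + I * S.card) * Nat.size B := by
    exact_mod_cast (hF.2 G hGi).trans hGd
  refine h.trans ?_
  rw [mul_assoc (I : ℝ)]
  gcongr

theorem size_le_three_mul_log {B : ℕ} (hB : 2 ≤ B) : (Nat.size B : ℝ) ≤ 3 * Real.log B := by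
  have h1 : 1 ≤ Nat.size B := Nat.size_pos.2 (by omega)
  have h2 : 2 ^ (Nat.size B - 1) ≤ B := Nat.lt_size.1 (by omega)
  have h3 : ((Nat.size B - 1 : ℕ) : ℝ) * Real.log 2 ≤ Real.log B := by
    rw [← Real.log_pow]
    exact Real.log_le_log (by positivity) (by exact_mod_cast h2)
  have h4 : Real.log 2 ≤ Real.log B := Real.log_le_log (by norm_num) (by exact_mod_cast hB)
  have h5 := Real.log_two_gt_d9
  push_cast [h1] at h3
  nlinarith

/-- The constant in the bounds on the error of minimum-description-length networks. -/
def mdlConst : ℝ := 52201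

variable {Ω : Type*} [MeasurableSpace Ω] {μ : Measure Ω} [IsProbabilityMeasure μ]

/-- The random network lies in a deterministic finite set, so the Chernoff bound is needed only for
fixed networks and no independence of the labels is used. -/
theorem measure_errorRate_gt {B n : ℕ} (hB : 2 ≤ B) (hN : 1 ≤ N) {P : SNP I J}
    (hP : P.BoundedOn N B) {ρ : ℝ} (hρ₀ : 0 ≤ ρ) (hρ : 1 ≤ I ∨ ρ < 1)
    {X : Fin n → Ω → Input I N} {Y : Fin n → Ω → ℕ} {fhat : Ω → Network I}
    (hX : ∀ i, Measurable (X i)) (hind : iIndepFun X μ) (hlaw : ∀ i, μ.map (X i) = unifInput I N)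
    (hY : ∀ᵐ ω ∂μ, ({i | (Y i ω : ℤ) ≠ P.output (X i ω)}.ncard : ℝ) ≤ ρ * n)
    (hYB : ∀ᵐ ω ∂μ, ∀ i, Y i ω ≤ B)
    (hf : ∀ᵐ ω ∂μ, (fhat ω).IsMDL (fun i => X i ω) (fun i => Y i ω)) {ε : ℝ} (hε : 0 < ε) :
    μ.real {ω | ρ + ε < errorRate N P (fhat ω)}
      < Real.exp (mdlConst * ((P.length : ℝ) ^ 3 * ((I + J : ℕ) : ℝ) ^ 2 + I * ρ * n) *
          Real.log (I + B) - n * ε ^ 2 / (2 * ρ + 2 * ε)) := by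
  classical
  have := isProbabilityMeasure_unifInput (I := I) hN
  set x := ((P.length : ℝ) ^ 3 * ((I + J : ℕ) : ℝ) ^ 2 + I * ρ * n) * Real.log (I + B) with hx
  have hB' : (2 : ℝ) ≤ B := by exact_mod_cast hB
  have hlog : 0 < Real.log (I + B) := Real.log_pos (by linarith [(Nat.cast_nonneg I : (0 : ℝ) ≤ I)])
  have hL : (1 : ℝ) ≤ P.length := by rw [SNP.length]; push_cast; linarith [(Nat.cast_nonneg P.body.length : (0 : ℝ) ≤ _)]
  have hV : (1 : ℝ) ≤ ((I + J : ℕ) : ℝ) := by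
    have : 1 ≤ I + J := by
      rcases P.ret with i | j
      · have := i.2; omega
      · have := j.2; omega
    exact_mod_cast this
  have hx0 : 0 < x := by positivity
  have hdesc : ∀ D : ℕ, (D : ℝ) ≤ 5800 * (P.length * ((I + J : ℕ) : ℝ) ^ 2 + I * ρ * n) *
      Nat.size B → D ≤ ⌊17400 * x⌋₊ := by
    intro D hD
    refine Nat.le_floor (hD.trans ?_)
    have h₁ : (Nat.size B : ℝ) ≤ 3 * Real.log (I + B) :=
      (size_le_three_mul_log hB).trans (by gcongr; linarith [(Nat.cast_nonneg I : (0 : ℝ) ≤ I)])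
    -- The simulation is linear in the program length; the cube is a weakening.
    have h₂ : (P.length : ℝ) ≤ (P.length : ℝ) ^ 3 := le_self_pow₀ hL (by norm_num)
    calc _ ≤ 5800 * ((P.length : ℝ) ^ 3 * ((I + J : ℕ) : ℝ) ^ 2 + I * ρ * n) *
          (3 * Real.log (I + B)) := by gcongr
      _ = 17400 * x := by rw [hx]; ring
  obtain ⟨S, hS, hcard⟩ := exists_finset_descLength_le I ⌊17400 * x⌋₊
  let T := S.filter fun F => ρ + ε < errorRate N P F
  let A : Network I → Set Ω := fun F =>
    {ω | ({i | X i ω ∈ {z | F.eval z ≠ P.output z}}.ncard : ℝ) ≤ ρ * n}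
  have hsub : μ.real {ω | ρ + ε < errorRate N P (fhat ω)} ≤ μ.real (⋃ F ∈ T, A F) := by
    refine ENNReal.toReal_mono (measure_ne_top _ _) (measure_mono_ae ?_)
    filter_upwards [hY, hYB, hf] with ω h₁ h₂ h₃ h₄
    refine Set.mem_biUnion (x := fhat ω) (Finset.mem_filter.2 ⟨hS _ (hdesc _
      (descLength_le_of_isMDL hB hN hP hρ h₃ h₁ h₂)), h₄⟩) ?_
    have : {i | X i ω ∈ {z | (fhat ω).eval z ≠ P.output z}}
        = {i | (Y i ω : ℤ) ≠ P.output (X i ω)} := by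
      ext i
      simp only [Set.mem_ofPred_eq, h₃.1 i]
      exact not_congr (by rw [← Int.cast_natCast, Int.cast_inj])
    change (Set.ncard _ : ℝ) ≤ _
    rwa [this]
  have hA : ∀ F ∈ T, μ.real (A F) ≤ Real.exp (-(n * ε ^ 2 / (2 * ρ + 2 * ε))) := fun F hF =>
    measure_count_le hX hind hlaw (Set.toFinite _).measurableSet hρ₀ hε
      (Finset.mem_filter.1 hF).2.le
  have hT : (T.card : ℝ) < Real.exp (mdlConst * x) := by
    calc (T.card : ℝ) ≤ 11 ^ ⌊17400 * x⌋₊ := by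
          exact_mod_cast (Finset.card_filter_le _ _).trans hcard
      _ ≤ Real.exp 3 ^ ⌊17400 * x⌋₊ := by
          gcongr
          have h := Real.exp_one_gt_d9
          rw [show (3 : ℝ) = (3 : ℕ) * 1 by norm_num, Real.exp_nat_mul]
          calc (11 : ℝ) ≤ 2.7 ^ 3 := by norm_num
            _ ≤ _ := by gcongr; linarith
      _ = Real.exp (⌊17400 * x⌋₊ * 3) := (Real.exp_nat_mul _ _).symm
      _ < _ := by
          -- 52201 = 3 · 17400 + 1, where 11 ≤ e³ gives the factor 3 and the 1 makes the inequality
          -- strict, as x > 0.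
          rw [Real.exp_lt_exp, mdlConst]
          have := Nat.floor_le (show 0 ≤ 17400 * x by positivity)
          linarith
  calc _ ≤ _ := hsub
    _ ≤ ∑ F ∈ T, μ.real (A F) := measureReal_biUnion_finset_le _ _
    _ ≤ T.card * Real.exp (-(n * ε ^ 2 / (2 * ρ + 2 * ε))) := by
        rw [← nsmul_eq_mul]; exact Finset.sum_le_card_nsmul _ _ _ hA
    _ < Real.exp (mdlConst * x) * Real.exp (-(n * ε ^ 2 / (2 * ρ + 2 * ε))) := by gcongr
    _ = _ := by rw [← Real.exp_add, hx]; ring_nf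

/-- The probability of an error at a random point, in terms of the tail of the error rate. -/
theorem measure_error_le (hN : 1 ≤ N) (P : SNP I J) {fhat : Ω → Network I}
    (hfhat : Measurable fhat) {η : ℝ} (hη : 0 ≤ η) :
    (μ.prod (unifInput I N)).real {p | (fhat p.1).eval p.2 ≠ P.output p.2}
      ≤ η + μ.real {ω | η < errorRate N P (fhat ω)} := by
  have := isProbabilityMeasure_unifInput (I := I) hN
  have hmeas : MeasurableSet {p : Ω × Input I N | (fhat p.1).eval p.2 ≠ P.output p.2} := by
    have : {p : Ω × Input I N | (fhat p.1).eval p.2 ≠ P.output p.2}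
        = ⋃ x : Input I N, (fhat ⁻¹' {F | F.eval x ≠ P.output x}) ×ˢ {x} := by
      ext ⟨ω, x⟩
      simp
    rw [this]
    exact .iUnion fun x => (hfhat trivial).prod (measurableSet_singleton x)
  have hbad : MeasurableSet {ω | η < errorRate N P (fhat ω)} :=
    hfhat (t := {F | η < errorRate N P F}) trivial
  rw [measureReal_def, measureReal_def, ← ENNReal.toReal_ofReal hη,
    ← ENNReal.toReal_add ENNReal.ofReal_ne_top (measure_ne_top _ _), ENNReal.toReal_ofReal hη]
  refine ENNReal.toReal_mono (by finiteness) ?_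
  rw [Measure.prod_apply hmeas]
  calc _ ≤ ∫⁻ ω, (ENNReal.ofReal η + {ω | η < errorRate N P (fhat ω)}.indicator 1 ω) ∂μ := by
        refine lintegral_mono fun ω => ?_
        by_cases h : η < errorRate N P (fhat ω)
        · rw [Set.indicator_of_mem (by exact h)]
          exact prob_le_one.trans le_add_self
        · refine le_trans ?_ le_self_add
          rw [← ofReal_measureReal]
          exact ENNReal.ofReal_le_ofReal (not_lt.1 h)
    _ = _ := by
        rw [lintegral_add_left measurable_const, lintegral_const, lintegral_indicator_one hbad]
        simp

/-- Per sample, α pays for describing the program and b ρ for the corrections; the surplus ρ / 2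
makes the tail decay. -/
theorem tail_exponent_le {b ρ α : ℝ} (hb : 2 ≤ b) (hρ : 0 < ρ) (hα : 0 ≤ α) :
    α + b * ρ + ρ / 2 ≤ (ρ * (2 * b + √(2 * b)) + 3 * α) ^ 2 /
      (2 * ρ + 2 * (ρ * (2 * b + √(2 * b)) + 3 * α)) := by
  obtain ⟨s, hs, hsb⟩ : ∃ s, s = √(2 * b) ∧ s ^ 2 = 2 * b :=
    ⟨_, rfl, Real.sq_sqrt (by linarith)⟩
  have hs2 : 2 ≤ s := by
    rw [hs]; exact Real.le_sqrt_of_sq_le (by linarith)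
  rw [← hs, ← hsb, le_div_iff₀ (by positivity), show b = s ^ 2 / 2 by linarith]
  -- After clearing the denominator, the difference of the sides has this coefficient at ρ², the one
  -- in `h₂` at ρ α, and 3 at α². Both are nonnegative since s ≥ 2.
  have h₁ : 0 ≤ s ^ 3 - s ^ 2 - s - 1 := by nlinarith [mul_nonneg (sub_nonneg.2 hs2) (sq_nonneg s)]
  have h₂ : 0 ≤ s ^ 2 + 4 * s - 5 := by nlinarith
  have := mul_nonneg (sq_nonneg ρ) h₁
  have := mul_nonneg (mul_nonneg hρ.le hα) h₂
  nlinarith [sq_nonneg α]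

end

/-- From I + B ≤ (I + 1) B and log (I + 1) ≤ I ≤ 2 I log B. This moves I out of the logarithm and
into K. -/
theorem log_add_le {I B : ℕ} (hB : 2 ≤ B) :
    Real.log (I + B) ≤ (2 * I + 1) * Real.log B := by
  have hB' : (2 : ℝ) ≤ B := by exact_mod_cast hB
  have hI : (0 : ℝ) ≤ I := Nat.cast_nonneg I
  have h₁ : Real.log (I + B) ≤ Real.log ((I + 1) * B) :=
    Real.log_le_log (by positivity) (by nlinarith)
  rw [Real.log_mul (by positivity) (by positivity)] at h₁
  have h₂ := Real.log_le_sub_one_of_pos (show (0 : ℝ) < I + 1 by positivity)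
  have h₃ := Real.log_two_gt_d9
  have h₄ : Real.log 2 ≤ Real.log B := Real.log_le_log (by norm_num) hB'
  nlinarith

/-! ### The two error bounds. -/

theorem theorem7p2 :
    ∃ c₃ : ℝ, 0 < c₃ ∧ ∃ K : ℕ → ℕ → ℕ → ℝ,
      ∀ (I J N B L V : ℕ) (P : SNP I J), 1 ≤ N → 2 ≤ B → P.length = L → I + J = V →
        P.BoundedOn N B →
      ∀ (Ω : Type*) [MeasurableSpace Ω] (μ : Measure Ω) [IsProbabilityMeasure μ]
        (n : ℕ) (ρ : ℝ), 0 ≤ ρ →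
      ∀ (X : Fin n → Ω → Input I N) (Y : Fin n → Ω → ℕ) (fhat : Ω → Network I),
        (∀ i, Measurable (X i)) →
        iIndepFun X μ →
        (∀ i, μ.map (X i) = unifInput I N) →
        (∀ᵐ ω ∂μ, ({i | (Y i ω : ℤ) ≠ P.output (X i ω)}.ncard : ℝ) ≤ ρ * n) →
        (∀ᵐ ω ∂μ, ∀ i, Y i ω ≤ B) →
        Measurable fhat →
        (∀ᵐ ω ∂μ, (fhat ω).IsMDL (fun i => X i ω) (fun i => Y i ω)) →
        (∀ ε : ℝ, 0 < ε →
          1 - Real.exp (c₃ * ((L : ℝ) ^ 3 * (V : ℝ) ^ 2 + I * ρ * n) * Real.log (I + B)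
                - n * ε ^ 2 / (2 * ρ + 2 * ε))
            < μ.real {ω | errorRate N P (fhat ω) ≤ ρ + ε}) ∧
        (0 < ρ → 0 < n →
          (μ.prod (unifInput I N)).real {p | (fhat p.1).eval p.2 ≠ P.output p.2}
            ≤ (1 + 2 * (c₃ * I * Real.log (I + B)) + √(2 * (c₃ * I * Real.log (I + B)))) * ρ
              + K I L V * (ρ⁻¹ * Real.log B / n)) := by
  refine ⟨mdlConst, by norm_num [mdlConst],
    -- The first summand bounds the term 3 α of ε, the 4 bounds the tail exp (-ρ n / 2).
    fun I L V => 3 * (mdlConst * ((L : ℝ) ^ 3 * (V : ℝ) ^ 2) * (2 * I + 1)) + 4, ?_⟩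
  rintro I J N B _ _ P hN hB rfl rfl hP Ω _ μ _ n ρ hρ₀ X Y fhat hX hind hlaw hY hYB hfhat hf
  have := isProbabilityMeasure_unifInput (I := I) hN
  have hc : 0 < mdlConst := by norm_num [mdlConst]
  have hB' : (2 : ℝ) ≤ B := by exact_mod_cast hB
  have hI : (0 : ℝ) ≤ I := Nat.cast_nonneg I
  have hlogB : 1 / 2 < Real.log B := by
    have h₃ := Real.log_two_gt_d9
    have h₄ : Real.log 2 ≤ Real.log B := Real.log_le_log (by norm_num) hB'
    linarith
  have hlog : 0 < Real.log (I + B) := Real.log_pos (by linarith)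
  refine ⟨fun ε hε => ?_, fun hρ hn => ?_⟩
  · by_cases h : 1 ≤ I ∨ ρ < 1
    · have hbad := measure_errorRate_gt hB hN hP hρ₀ h hX hind hlaw hY hYB hf hε
      have hm : MeasurableSet {ω | errorRate N P (fhat ω) ≤ ρ + ε} :=
        hfhat (t := {F | errorRate N P F ≤ ρ + ε}) trivial
      have hcompl := probReal_compl_eq_one_sub (μ := μ) hm
      have hset : {ω | errorRate N P (fhat ω) ≤ ρ + ε}ᶜ
          = {ω | ρ + ε < errorRate N P (fhat ω)} := by
        ext ω; simp
      rw [hset] at hcompl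
      linarith
    · push Not at h
      have huniv : {ω | errorRate N P (fhat ω) ≤ ρ + ε} = Set.univ :=
        Set.eq_univ_of_forall fun ω => by
          have : errorRate N P (fhat ω) ≤ 1 := measureReal_le_one
          simp only [Set.mem_ofPred_eq]
          linarith [h.2]
      rw [huniv, probReal_univ]
      linarith [Real.exp_pos (mdlConst * ((P.length : ℝ) ^ 3 * ((I + J : ℕ) : ℝ) ^ 2 +
        I * ρ * n) * Real.log (I + B) - n * ε ^ 2 / (2 * ρ + 2 * ε))]
  · have hn' : (0 : ℝ) < n := by exact_mod_cast hn
    set b := mdlConst * I * Real.log (I + B) with hb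
    have hb0 : 0 ≤ b := by positivity
    have hmain : 0 ≤ (2 * b + √(2 * b)) * ρ := by positivity
    have hK : 0 ≤ (3 * (mdlConst * ((P.length : ℝ) ^ 3 * ((I + J : ℕ) : ℝ) ^ 2) * (2 * I + 1)) + 4)
        * (ρ⁻¹ * Real.log B / n) := by positivity
    by_cases hρ1 : 1 ≤ ρ
    · have : (μ.prod (unifInput I N)).real {p | (fhat p.1).eval p.2 ≠ P.output p.2} ≤ 1 :=
        measureReal_le_one
      nlinarith
    push Not at hρ1
    -- For I = 0 one has b = 0, so the exponent estimate is unavailable. But then no label is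
    -- corrupted and, as n ≥ 1, the only input is a data point.
    by_cases hI0 : I = 0
    · have hnull : μ.real {ω | ρ < errorRate N P (fhat ω)} = 0 := by
        rw [measureReal_eq_zero_iff, measure_eq_zero_iff_ae_notMem]
        filter_upwards [hY, hf] with ω h₁ h₂
        have hall : ∀ x : Input I N, (fhat ω).eval x = P.output x := by
          intro x
          have hx : x = X ⟨0, hn⟩ ω := by subst hI0; exact Subsingleton.elim _ _
          rw [hx, h₂.1, ← eq_output_of_isEmpty hI0 hρ1 h₂.1 h₁]
          simp
        simp [errorRate, hall, hρ₀]
      have := measure_error_le (μ := μ) hN P hfhat hρ₀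
      rw [hnull] at this
      nlinarith
    · have hI1 : (1 : ℝ) ≤ I := by exact_mod_cast Nat.one_le_iff_ne_zero.2 hI0
      have hb2 : 2 ≤ b := by
        have h₁ : 1 / 2 ≤ Real.log (I + B) :=
          hlogB.le.trans (Real.log_le_log (by linarith) (by linarith))
        calc (2 : ℝ) ≤ mdlConst * 1 * (1 / 2) := by norm_num [mdlConst]
          _ ≤ b := by rw [hb]; gcongr
      set a := mdlConst * ((P.length : ℝ) ^ 3 * ((I + J : ℕ) : ℝ) ^ 2) with ha
      set α := a * Real.log (I + B) / n with hα
      have ha0 : 0 ≤ a := by positivity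
      have hα0 : 0 ≤ α := by positivity
      set ε := ρ * (2 * b + √(2 * b)) + 3 * α with hε
      have hε0 : 0 < ε := by positivity
      have htail := (measure_errorRate_gt hB hN hP hρ₀ (Or.inr hρ1) hX hind hlaw hY hYB hf hε0).le
      have hexp : mdlConst * ((P.length : ℝ) ^ 3 * ((I + J : ℕ) : ℝ) ^ 2 + I * ρ * n) *
          Real.log (I + B) - n * ε ^ 2 / (2 * ρ + 2 * ε) ≤ -(ρ * n / 2) := by
        have h := mul_le_mul_of_nonneg_left (tail_exponent_le hb2 hρ hα0) hn'.le
        have hnα : n * α = a * Real.log (I + B) := by rw [hα]; field_simp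
        rw [← hε] at h
        have e : mdlConst * ((P.length : ℝ) ^ 3 * ((I + J : ℕ) : ℝ) ^ 2 + I * ρ * n) *
            Real.log (I + B) = n * α + n * (b * ρ) := by rw [hnα, ha, hb]; ring
        rw [e, mul_div_assoc]
        linarith
      -- The inequality exp (-y) ≤ 1 / y is the source of ρ⁻¹ / n in the bound.
      have hsmall : Real.exp (-(ρ * n / 2)) ≤ 2 * (ρ⁻¹ / n) := by
        have h₁ : ρ * n / 2 ≤ Real.exp (ρ * n / 2) := by
          linarith [Real.add_one_le_exp (ρ * n / 2)]
        rw [Real.exp_neg]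
        calc (Real.exp (ρ * n / 2))⁻¹ ≤ (ρ * n / 2)⁻¹ := inv_anti₀ (by positivity) h₁
          _ = _ := by field_simp
      have hle := measure_error_le (μ := μ) hN P hfhat (show 0 ≤ ρ + ε by positivity)
      have h₁ : α ≤ a * (2 * I + 1) * (ρ⁻¹ * Real.log B / n) := by
        have hρi : 1 ≤ ρ⁻¹ := (one_le_inv₀ hρ).2 hρ1.le
        calc α ≤ a * ((2 * I + 1) * Real.log B) / n := by
              rw [hα]; gcongr; exact log_add_le hB
          _ = a * (2 * I + 1) * (1 * Real.log B / n) := by ring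
          _ ≤ _ := by gcongr
      have h₂ : 2 * (ρ⁻¹ / n) ≤ 4 * (ρ⁻¹ * Real.log B / n) := by
        have : 0 ≤ ρ⁻¹ / n := by positivity
        calc _ ≤ 4 * (ρ⁻¹ / n * Real.log B) := by nlinarith
          _ = _ := by ring
      have h₃ := htail.trans (Real.exp_le_exp.2 hexp)
      rw [hε] at hle h₃
      nlinarith
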